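/- Let $d\ge 1$ and let $f:[0,1]^d\to\mathbb R$. For $g:[0,1]^s\to\mathbb R$ and a box $[\mathbf a,\mathbf b]\subset[0,1]^s$, $\mathbf a<\mathbf b$ in every coordinate, let $$\Delta^{(s)}(g;[\mathbf a,\mathbf b])=\sum_{j\in\{0,1\}^s}(-1)^{j_1+\dots+j_s}\,g\bigl(b_1+j_1(a_1-b_1),\dots,b_s+j_s(a_s-b_s)\bigr),$$ and let the Vitali variation of $g$ be $V^{(s)}(g)=\sup_{\mathcal P}\sum_{A\in\mathcal P}|\Delta^{(s)}(g;A)|$, the supremum being over all partitions $\mathcal P$ of $[0,1]^s$ into boxes generated by $s$ finite partitions of $[0,1]$. Let $\mathrm{Var}_{HK}f$ (respectively $\mathrm{Var}_{HK\mathbf 0}f$) be the sum, over all non-empty $S\subset\{1,\dots,d\}$, of the $|S|$-dimensional Vitali variation of the restriction of $f$ to the face of $[0,1]^d$ on which $x_i=1$ (respectively $x_i=0$) for all $i\notin S$. The function $f$ has bounded HK-variation if $\mathrm{Var}_{HK}f<\infty$; it is right-continuous if it is right-continuous in each coordinate separately, at every point. A function $h$ on $[0,1]^d$ is completely monotone if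 for every $1\le s\le d$ every $s$-dimensional closed axis-parallel box in $[0,1]^d$ has non-negative $s$-dimensional quasi-volume $\Delta^{(s)}$ with respect to $h$. A Jordan decomposition of $f$ is a pair $(f^+,f^-)$ of completely monotone functions on $[0,1]^d$ with $f^+(\mathbf 0)=f^-(\mathbf 0)=0$, $f=f(\mathbf 0)+f^+-f^-$ and $\mathrm{Var}_{HK\mathbf 0}f=\mathrm{Var}_{HK\mathbf 0}f^++\mathrm{Var}_{HK\mathbf 0}f^-$. For a finite signed Borel measure $\nu$ on $[0,1]^d$ let $\nu=\nu^+-\nu^-$ be its Jordan decomposition and $\mathrm{Var}_{\mathrm{total}}\,\nu=\nu^+([0,1]^d)+\nu^-([0,1]^d)$. Consider the relations $$(1)\quad f(\mathbf x)=\nu([\mathbf 0,\mathbf x])\ \text{ for all }\mathbf x\in[0,1]^d,\qquad (2)\quad \mathrm{Var}_{\mathrm{total}}\,\nu=\mathrm{Var}_{HK\mathbf 0}f+|f(\mathbf 0)|,$$ $$(3)\quad f^+(\mathbf x)=\nu^+([\mathbf 0,\mathbf x]\setminus\{\mathbf 0\})\ \text{ and }\ f^-(\mathbf x)=\nu^-([\mathbf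 0,\mathbf x]\setminus\{\mathbf 0\})\ \text{ for all }\mathbf x\in[0,1]^d.$$ Theorem 3. (a) Let $f$ be a right-continuous function on $[0,1]^d$ of bounded HK-variation. Then there is a unique finite signed Borel measure $\nu$ on $[0,1]^d$ satisfying (1). For this $\nu$, (2) holds, and $f$ has exactly one Jordan decomposition $(f^+,f^-)$, namely the one given by (3). (b) Let $\nu$ be a finite signed Borel measure on $[0,1]^d$. Then there is a right-continuous function $f$ of bounded HK-variation on $[0,1]^d$ satisfying (1) and (2), and it is the only right-continuous function of bounded HK-variation satisfying (1). Moreover, $f$ has exactly one Jordan decomposition $(f^+,f^-)$, namely the one given by (3). -/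

import Mathlib

open MeasureTheory
open scoped ENNReal

namespace HardyKrause

/-- The cube `[0,1]^ι`, with the product (Borel) structure; `[0,1]^d` is `Cube (Fin d)`. -/
abbrev Cube (ι : Type*) : Type _ := ι → unitInterval

/-- The quasi-volume of the box `[a, b]` generated by `g`: the sum over the corners of the box of
`(-1) ^ (number of coordinates equal to the lower one)` times the value of `g` at the corner.
The set `T` is the set of coordinates in which the corner is the lower one. -/
def quasiVolume {ι : Type*} [Fintype ι] [DecidableEq ι] (g : Cube ι → ℝ) (a b : Cube ι) : ℝ :=
  ∑ T : Finset ι, (-1 : ℝ) ^ T.card * g (fun i => if i ∈ T then a i else b i)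

/-- A partition `0 = x₀ < x₁ < ⋯ < x_m = 1` of the unit interval. -/
structure UnitPartition where
  /-- the number of subintervals -/
  m : ℕ
  /-- the partition points -/
  pt : Fin (m + 1) → unitInterval
  strictMono : StrictMono pt
  pt_zero : pt 0 = 0
  pt_last : pt (Fin.last m) = 1

/-- The variation of `g` on `[0,1]^ι` in the sense of Vitali: the supremum, over all grids generated
by one partition of `[0,1]` for each coordinate, of the sum of `|quasi-volume|` over the boxes
of the grid. -/
noncomputable def vitaliVariation {ι : Type*} [Fintype ι] [DecidableEq ι] (g : Cube ι → ℝ) :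
    ℝ≥0∞ :=
  ⨆ P : ι → UnitPartition, ∑ l : (∀ i, Fin (P i).m),
    ENNReal.ofReal |quasiVolume g (fun i => (P i).pt (l i).castSucc) (fun i => (P i).pt (l i).succ)|

/-- The parametrization, by `[0,1]^S`, of the face of `[0,1]^d` on which the coordinates outside `S`
are those of `c`. -/
def face {d : ℕ} (S : Finset (Fin d)) (c : Cube (Fin d)) (y : Cube S) : Cube (Fin d) :=
  fun i => if h : i ∈ S then y ⟨i, h⟩ else c i

/-- The variation in the sense of Hardy and Krause anchored at `c` (a corner of the cube): the sum
of the Vitali variations of the restrictions of `f` to all faces of positive dimension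
adjacent to `c`. -/
noncomputable def anchoredVariation {d : ℕ} (c : Cube (Fin d)) (f : Cube (Fin d) → ℝ) : ℝ≥0∞ :=
  ∑ S : Finset (Fin d) with S.Nonempty, vitaliVariation (fun y : Cube S => f (face S c y))

/-- The HK-variation: the variation in the sense of Hardy and Krause anchored at `1`. -/
noncomputable def varHK {d : ℕ} (f : Cube (Fin d) → ℝ) : ℝ≥0∞ := anchoredVariation 1 f

/-- The HK0-variation: the variation in the sense of Hardy and Krause anchored at `0`. -/
noncomputable def varHK0 {d : ℕ} (f : Cube (Fin d) → ℝ) : ℝ≥0∞ := anchoredVariation 0 f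

/-- `f` has bounded HK-variation. -/
def BoundedHK {d : ℕ} (f : Cube (Fin d) → ℝ) : Prop := varHK f < ∞

/-- `f` is right-continuous in each coordinate, at every point. -/
def RightContinuous {d : ℕ} (f : Cube (Fin d) → ℝ) : Prop :=
  ∀ (x : Cube (Fin d)) (i : Fin d),
    ContinuousWithinAt (fun t : unitInterval => f (Function.update x i t)) (Set.Ici (x i)) (x i)

/-- `h` is completely monotone: every axis-parallel box in `[0,1]^d`, of any dimension `s ≥ 1`
(and in any position, not only on the faces of the cube), has non-negative `s`-dimensional
quasi-volume. -/
def CompletelyMonotone {d : ℕ} (h : Cube (Fin d) → ℝ) : Prop :=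
  ∀ (S : Finset (Fin d)), S.Nonempty → ∀ (c : Cube (Fin d)) (a b : Cube S), (∀ i, a i < b i) →
    0 ≤ quasiVolume (fun y : Cube S => h (face S c y)) a b

/-- `f = f 0 + fp - fm` is a Jordan decomposition of the function `f`. -/
structure IsJordanDecomposition {d : ℕ} (f fp fm : Cube (Fin d) → ℝ) : Prop where
  pos_completelyMonotone : CompletelyMonotone fp
  neg_completelyMonotone : CompletelyMonotone fm
  pos_zero : fp 0 = 0
  neg_zero : fm 0 = 0
  eq_add_sub : ∀ x, f x = f 0 + fp x - fm x
  varHK0_eq : varHK0 f = varHK0 fp + varHK0 fm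

/-- `f` is the distribution function of the signed measure `ν`: `f x = ν [0, x]` for all `x`. -/
def IsDistributionFunction {d : ℕ} (f : Cube (Fin d) → ℝ) (ν : SignedMeasure (Cube (Fin d))) :
    Prop :=
  ∀ x, f x = ν (Set.Icc 0 x)

end HardyKrause

/-!
The basic fact is that on a finite grid every function `f` is the distribution function of a
discrete signed measure (`exists_grid_weight`, Möbius inversion). A quasi-volume generated by a
distribution function is the mass of a half-open box (`quasiVolume_step_face`,
`quasiVolume_distr`), so each identity between quasi-volumes reduces to one between indicators of
boxes. In particular the weight of a grid point is a quasi-volume in the smallest face through `0`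
that contains it; hence the mass of the discrete measure is at most `Var_HK0 f + |f 0|`
(`sum_weight_le`), and it is a positive measure when `f` is completely monotone and `f 0 ≥ 0`.
Inclusion–exclusion over the faces shows that `Var_HK f < ∞` implies `Var_HK0 f < ∞`
(`BoundedHK.varHK0_lt_top`).

*Existence* (`exists_measure_of_rightContinuous`). The positive and negative parts of the discrete
measures belonging to all finite grids have bounded mass, so by compactness they converge weakly
along an ultrafilter of finer and finer grids. At each `x` the discrete measures of `[0, x]` are
eventually equal to `f x`, and the limit measures have null mass on the frontier of `[0, x]` as long
as the coordinates of `x` avoid a countable set. So `f` and the distribution function of the limit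
agree off countably many values of the coordinates, and therefore everywhere, both being
right-continuous in each coordinate.

*Total variation* (`varHK0_eq_of_mutuallySingular`). The mass of the limit is at most
`Var_HK0 f + |f 0|`, and the Jordan decomposition of a signed measure has the least mass among all
ways to write it as a difference. The opposite inequality is immediate, since the boxes of a
grid in a face are disjoint and the half-open faces through `0` partition the cube minus the origin.

*Jordan decompositions* (`isJordanDecomposition_iff`). Let `(p, n)` be a Jordan decomposition of
`f`, and let `V` be the distribution function of `|ν|` away from the origin. Restricting `ν` to
`[0, x]`, and to its complement, gives `V x ≤ p x + n x` and `V 1 - V x ≤ (p + n) 1 - (p + n) x`,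
while the additivity of the variations gives `(p + n) 1 ≤ V 1`. Hence `p + n = V`, and `p - n` is
known, so `p` and `n` are determined. No continuity of `p` and `n` is needed.
-/

namespace HardyKrause

/-! ### Quasi-volumes of step functions -/

section QuasiVolume

variable {ι : Type*}

/-- The step function `x ↦ 1[z ≤ x]`: the distribution function of the unit mass at `z`. -/
noncomputable def step (z : Cube ι) : Cube ι → ℝ := (Set.Ici z).indicator 1

/-- The half-open box `(a, b]`. -/
def box (a b : Cube ι) : Set (Cube ι) := Set.univ.pi fun i => Set.Ioc (a i) (b i)

theorem mem_box {a b z : Cube ι} : z ∈ box a b ↔ ∀ i, a i < z i ∧ z i ≤ b i := by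
  simp [box]

theorem step_of_le {z x : Cube ι} (h : z ≤ x) : step z x = 1 := by
  simp [step, h]

theorem step_of_not_le {z x : Cube ι} (h : ¬ z ≤ x) : step z x = 0 := by
  simp [step, h]

theorem step_inf (z x y : Cube ι) : step z (y ⊓ x) = step z y * step z x := by
  by_cases hy : z ≤ y
  · by_cases hx : z ≤ x
    · simp [step_of_le hx, step_of_le hy, step_of_le (le_inf hy hx)]
    · rw [step_of_not_le hx, step_of_not_le fun h => hx (h.trans inf_le_right), mul_zero]
  · rw [step_of_not_le hy, step_of_not_le fun h => hy (h.trans inf_le_left), zero_mul]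

theorem step_nonneg (z x : Cube ι) : 0 ≤ step z x :=
  Set.indicator_nonneg (by simp) _

theorem step_le_one (z x : Cube ι) : step z x ≤ 1 :=
  Set.indicator_le_self' (by simp) _

variable [Fintype ι]

theorem step_eq_prod (z x : Cube ι) :
    step z x = ∏ i, (Set.Ici (z i)).indicator (1 : unitInterval → ℝ) (x i) := by
  by_cases h : z ≤ x
  · rw [step_of_le h, Finset.prod_eq_one]
    intro i _
    simp [h i]
  · rw [step_of_not_le h]
    obtain ⟨i, hi⟩ := not_forall.1 h
    exact (Finset.prod_eq_zero (Finset.mem_univ i) (by simpa using hi)).symm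

variable [DecidableEq ι]

theorem quasiVolume_sub (g h : Cube ι → ℝ) (a b : Cube ι) :
    quasiVolume (fun x => g x - h x) a b = quasiVolume g a b - quasiVolume h a b := by
  simp [quasiVolume, mul_sub, Finset.sum_sub_distrib]

theorem quasiVolume_add (g h : Cube ι → ℝ) (a b : Cube ι) :
    quasiVolume (fun x => g x + h x) a b = quasiVolume g a b + quasiVolume h a b := by
  simp [quasiVolume, mul_add, Finset.sum_add_distrib]

theorem quasiVolume_const_mul (r : ℝ) (g : Cube ι → ℝ) (a b : Cube ι) :
    quasiVolume (fun x => r * g x) a b = r * quasiVolume g a b := by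
  simp only [quasiVolume, Finset.mul_sum]
  exact Finset.sum_congr rfl fun _ _ => by ring

theorem quasiVolume_sum {κ : Type*} (K : Finset κ) (g : κ → Cube ι → ℝ) (a b : Cube ι) :
    quasiVolume (fun x => ∑ k ∈ K, g k x) a b = ∑ k ∈ K, quasiVolume (g k) a b := by
  simp only [quasiVolume, Finset.mul_sum]
  exact Finset.sum_comm

/-- The quasi-volume only depends on the values at the corners of the box. -/
theorem quasiVolume_congr {g h : Cube ι → ℝ} {a b : Cube ι}
    (H : ∀ x, (∀ i, x i = a i ∨ x i = b i) → g x = h x) :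
    quasiVolume g a b = quasiVolume h a b := by
  refine Finset.sum_congr rfl fun T _ => ?_
  rw [H]
  intro i
  by_cases hi : i ∈ T <;> simp [hi]

theorem quasiVolume_prod (φ : ι → unitInterval → ℝ) (a b : Cube ι) :
    quasiVolume (fun x => ∏ i, φ i (x i)) a b = ∏ i, (φ i (b i) - φ i (a i)) := by
  have h : ∀ i, φ i (b i) - φ i (a i) = -φ i (a i) + φ i (b i) := fun i => by ring
  simp only [h]
  rw [Finset.prod_add]
  simp only [Finset.powerset_univ, quasiVolume]
  refine Finset.sum_congr rfl fun T _ => ?_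
  rw [Finset.prod_neg, ← Finset.prod_sdiff (Finset.subset_univ T), mul_assoc]
  congr 1
  rw [mul_comm]
  congr 1
  · exact Finset.prod_congr rfl fun i hi => by simp [hi]
  · exact Finset.prod_congr rfl fun i hi => by simp [(Finset.mem_sdiff.1 hi).2]

/-- The quasi-volume generated by a unit mass at `z` tells whether `z` lies in the half-open box. -/
theorem quasiVolume_step (z : Cube ι) {a b : Cube ι} (hab : a ≤ b) :
    quasiVolume (step z) a b = (box a b).indicator 1 z := by
  have : step z = fun x => ∏ i, (Set.Ici (z i)).indicator (1 : unitInterval → ℝ) (x i) :=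
    funext (step_eq_prod z)
  rw [this, quasiVolume_prod (fun i => (Set.Ici (z i)).indicator (1 : unitInterval → ℝ))]
  by_cases hz : z ∈ box a b
  · rw [Set.indicator_of_mem hz, Finset.prod_eq_one, Pi.one_apply]
    intro i _
    have := mem_box.1 hz i
    simp [this.1, this.2]
  · rw [Set.indicator_of_notMem hz]
    obtain ⟨i, hi⟩ := not_forall.1 fun h => hz (mem_box.2 h)
    apply Finset.prod_eq_zero (Finset.mem_univ i)
    by_cases h1 : z i ≤ b i
    · have h2 : z i ≤ a i := not_lt.1 fun h => hi ⟨h, h1⟩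
      simp [h1, h2]
    · have h2 : ¬ z i ≤ a i := fun h => h1 (h.trans (hab i))
      simp [h1, h2]

end QuasiVolume

section Face

variable {d : ℕ}

/-- The set of points whose coordinates in `S` lie in the half-open box `(a, b]` and whose other
coordinates are at most those of `c`. Its mass is the quasi-volume, generated by the distribution
function, of the box `[a, b]` in the face through `c`. -/
def cell (S : Finset (Fin d)) (c : Cube (Fin d)) (a b : Cube S) : Set (Cube (Fin d)) :=
  {z | (∀ i : S, a i < z i ∧ z i ≤ b i) ∧ ∀ i ∉ S, z i ≤ c i}

theorem le_face_iff {S : Finset (Fin d)} {c z : Cube (Fin d)} {y : Cube S} :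
    z ≤ face S c y ↔ (∀ i : S, z i ≤ y i) ∧ ∀ i ∉ S, z i ≤ c i := by
  constructor
  · intro h
    refine ⟨fun i => ?_, fun i hi => ?_⟩
    · have := h i
      simpa [face] using this
    · have := h i
      simpa [face, hi] using this
  · rintro ⟨h1, h2⟩ i
    by_cases hi : i ∈ S
    · simpa [face, hi] using h1 ⟨i, hi⟩
    · simpa [face, hi] using h2 i hi

theorem step_face (S : Finset (Fin d)) (c z : Cube (Fin d)) (y : Cube S) :
    step z (face S c y) =
      {z : Cube (Fin d) | ∀ i ∉ S, z i ≤ c i}.indicator 1 z * step (fun i : S => z i) y := by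
  by_cases h1 : (fun i : S => z i) ≤ y
  · by_cases h2 : z ∈ {z : Cube (Fin d) | ∀ i ∉ S, z i ≤ c i}
    · rw [step_of_le (le_face_iff.2 ⟨h1, h2⟩), step_of_le h1, Set.indicator_of_mem h2]
      simp
    · rw [step_of_not_le fun h => h2 (le_face_iff.1 h).2, Set.indicator_of_notMem h2, zero_mul]
  · rw [step_of_not_le fun h => h1 (le_face_iff.1 h).1, step_of_not_le h1, mul_zero]

theorem quasiVolume_step_face (S : Finset (Fin d)) (c z : Cube (Fin d)) {a b : Cube S}
    (hab : a ≤ b) :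
    quasiVolume (fun y => step z (face S c y)) a b = (cell S c a b).indicator 1 z := by
  simp only [step_face]
  rw [quasiVolume_const_mul, quasiVolume_step _ hab]
  by_cases h1 : (fun i : S => z i) ∈ box a b
  · by_cases h2 : z ∈ {z : Cube (Fin d) | ∀ i ∉ S, z i ≤ c i}
    · have h3 : z ∈ cell S c a b := ⟨mem_box.1 h1, h2⟩
      rw [Set.indicator_of_mem h1, Set.indicator_of_mem h3, Set.indicator_of_mem h2]
      simp
    · rw [Set.indicator_of_notMem h2, Set.indicator_of_notMem fun h : z ∈ cell S c a b => h2 h.2,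
        zero_mul]
  · rw [Set.indicator_of_notMem h1,
      Set.indicator_of_notMem fun h : z ∈ cell S c a b => h1 (mem_box.2 h.1), mul_zero]

end Face

/-! ### Representation on finite grids and Vitali variation -/

/-- Möbius inversion in a finite partial order. -/
theorem exists_sum_indicator_Ici {α : Type*} [PartialOrder α] (X : Finset α) (f : α → ℝ) :
    ∃ w : α → ℝ, ∀ x ∈ X, f x = ∑ z ∈ X, w z * (Set.Ici z).indicator 1 x := by
  classical
  induction X using Finset.strongInduction with
  | H X ih =>
    rcases X.eq_empty_or_nonempty with rfl | hX
    · exact ⟨0, by simp⟩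
    · obtain ⟨m, hm⟩ := X.exists_maximal hX
      obtain ⟨w, hw⟩ := ih (X.erase m) (Finset.erase_ssubset hm.1)
      refine ⟨Function.update w m
        (f m - ∑ z ∈ X.erase m, w z * (Set.Ici z).indicator 1 m), fun x hx => ?_⟩
      rw [← Finset.add_sum_erase X _ hm.1, Function.update_self]
      have h : ∀ x, ∑ z ∈ X.erase m, Function.update w m
          (f m - ∑ z ∈ X.erase m, w z * (Set.Ici z).indicator 1 m) z * (Set.Ici z).indicator 1 x =
          ∑ z ∈ X.erase m, w z * (Set.Ici z).indicator 1 x := fun x =>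
        Finset.sum_congr rfl fun z hz => by
          rw [Function.update_of_ne (Finset.ne_of_mem_erase hz)]
      rw [h]
      by_cases hxm : x = m
      · subst hxm
        simp
      · have : ¬ m ≤ x := fun h' => hxm (hm.eq_of_ge hx h')
        rw [Set.indicator_of_notMem (by simpa using this), mul_zero, zero_add]
        exact hw x (Finset.mem_erase.2 ⟨hxm, hx⟩)

section Grid

variable {ι : Type*} [Fintype ι] [DecidableEq ι]

/-- The grid points of `[0,1]^ι` with all coordinates in `F`. -/
def gridPts (ι : Type*) [Fintype ι] [DecidableEq ι] (F : Finset unitInterval) :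
    Finset (Cube ι) := Fintype.piFinset fun _ => F

theorem mem_gridPts {F : Finset unitInterval} {x : Cube ι} : x ∈ gridPts ι F ↔ ∀ i, x i ∈ F :=
  Fintype.mem_piFinset

/-- On a finite grid, every function is the distribution function of a signed measure carried by
the grid. -/
theorem exists_grid_weight (F : Finset unitInterval) (g : Cube ι → ℝ) :
    ∃ w : Cube ι → ℝ, ∀ x ∈ gridPts ι F, g x = ∑ z ∈ gridPts ι F, w z * step z x :=
  exists_sum_indicator_Ici _ g

/-- The predecessor of `t` in `F`, or `0` if there is none. -/
noncomputable def pred (F : Finset unitInterval) (t : unitInterval) : unitInterval :=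
  (F.filter (· < t)).sup id

theorem pred_lt {F : Finset unitInterval} {t : unitInterval} (ht : 0 < t) : pred F t < t := by
  refine (Finset.sup_lt_iff ht).2 ?_
  simp

theorem pred_le (F : Finset unitInterval) (t : unitInterval) : pred F t ≤ t := by
  refine Finset.sup_le ?_
  simp only [Finset.mem_filter, id]
  exact fun b hb => hb.2.le

theorem le_pred {F : Finset unitInterval} {s t : unitInterval} (hs : s ∈ F) (h : s < t) :
    s ≤ pred F t :=
  Finset.le_sup (f := id) (Finset.mem_filter.2 ⟨hs, h⟩)

theorem pred_mem {F : Finset unitInterval} (h0 : 0 ∈ F) (t : unitInterval) : pred F t ∈ F := by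
  rcases (F.filter (· < t)).eq_empty_or_nonempty with h | h
  · rw [pred, h]
    exact h0
  · obtain ⟨s, hs, h'⟩ := Finset.exists_mem_eq_sup _ h id
    rw [pred, h']
    exact Finset.mem_of_mem_filter _ hs

/-- The partition of the unit interval with a prescribed finite set of partition points. -/
theorem exists_unitPartition (F : Finset unitInterval) (h0 : 0 ∈ F) (h1 : 1 ∈ F) :
    ∃ P : UnitPartition, Set.range P.pt = F := by
  have hc : 0 < F.card := Finset.card_pos.2 ⟨0, h0⟩
  have hc' : F.card = (F.card - 1) + 1 := by omega
  refine ⟨⟨F.card - 1, F.orderEmbOfFin hc', (F.orderEmbOfFin hc').strictMono, ?_, ?_⟩, ?_⟩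
  · have h : (0 : unitInterval) ∈ Set.range (F.orderEmbOfFin hc') := by
      rw [Finset.range_orderEmbOfFin]
      exact h0
    obtain ⟨k, hk⟩ := h
    exact le_antisymm (((F.orderEmbOfFin hc').monotone (Fin.zero_le k)).trans hk.le) bot_le
  · have h : (1 : unitInterval) ∈ Set.range (F.orderEmbOfFin hc') := by
      rw [Finset.range_orderEmbOfFin]
      exact h1
    obtain ⟨k, hk⟩ := h
    exact le_antisymm le_top (hk.ge.trans ((F.orderEmbOfFin hc').monotone (Fin.le_last k)))
  · exact Finset.range_orderEmbOfFin F hc'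

theorem UnitPartition.pred_pt_succ {P : UnitPartition} {F : Finset unitInterval}
    (hF : Set.range P.pt = F) (l : Fin P.m) : pred F (P.pt l.succ) = P.pt l.castSucc := by
  apply le_antisymm
  · refine Finset.sup_le fun s hs => ?_
    rw [Finset.mem_filter, ← Finset.mem_coe, ← hF] at hs
    obtain ⟨⟨k, rfl⟩, hk⟩ := hs
    exact P.strictMono.monotone (Fin.le_castSucc_iff.2 (P.strictMono.lt_iff_lt.1 hk))
  · refine le_pred ?_ (P.strictMono Fin.castSucc_lt_succ)
    rw [← Finset.mem_coe, ← hF]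
    exact ⟨_, rfl⟩

theorem mem_box_pred_iff {F : Finset unitInterval} {y z : Cube ι} (hz : z ∈ gridPts ι F)
    (hy : ∀ i, 0 < y i) : z ∈ box (fun i => pred F (y i)) y ↔ z = y := by
  rw [mem_box]
  constructor
  · intro h
    funext i
    by_contra hne
    exact ((h i).1.trans_le (le_pred (mem_gridPts.1 hz i) (lt_of_le_of_ne (h i).2 hne))).false
  · rintro rfl i
    exact ⟨pred_lt (hy i), le_rfl⟩

/-- The quasi-volume of a box with corners in the grid, in terms of the grid weights. -/
theorem quasiVolume_eq_sum_weight {F : Finset unitInterval} {g w : Cube ι → ℝ}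
    (hw : ∀ x ∈ gridPts ι F, g x = ∑ z ∈ gridPts ι F, w z * step z x) {a b : Cube ι}
    (hab : a ≤ b) (ha : a ∈ gridPts ι F) (hb : b ∈ gridPts ι F) :
    quasiVolume g a b = ∑ z ∈ gridPts ι F, w z * (box a b).indicator 1 z := by
  rw [mem_gridPts] at ha hb
  rw [quasiVolume_congr (h := fun x => ∑ z ∈ gridPts ι F, w z * step z x), quasiVolume_sum]
  · simp only [quasiVolume_const_mul, quasiVolume_step _ hab]
  · refine fun x hx => hw x (mem_gridPts.2 fun i => ?_)
    rcases hx i with h | h <;> rw [h]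
    exacts [ha i, hb i]

/-- The quasi-volume of a box with corners in the grid is the sum of the quasi-volumes of the grid
boxes inside it, which are labelled by their upper corners. -/
theorem quasiVolume_eq_sum_cells {F : Finset unitInterval} (h0 : 0 ∈ F) (g : Cube ι → ℝ)
    {a b : Cube ι} (hab : a ≤ b) (ha : a ∈ gridPts ι F) (hb : b ∈ gridPts ι F) :
    quasiVolume g a b = ∑ y ∈ gridPts ι F with ∀ i, 0 < y i,
      quasiVolume g (fun i => pred F (y i)) y * (box a b).indicator 1 y := by
  obtain ⟨w, hw⟩ := exists_grid_weight F g
  rw [quasiVolume_eq_sum_weight hw hab ha hb, Finset.sum_filter]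
  refine Finset.sum_congr rfl fun y hy => ?_
  split_ifs with hpos
  · congr 1
    rw [quasiVolume_eq_sum_weight hw (fun i => pred_le F (y i))
      (mem_gridPts.2 fun i => pred_mem h0 _) hy, Finset.sum_eq_single y]
    · rw [Set.indicator_of_mem ((mem_box_pred_iff hy hpos).2 rfl)]
      simp
    · intro z hz hzy
      rw [Set.indicator_of_notMem (mt (mem_box_pred_iff hz hpos).1 hzy), mul_zero]
    · exact fun h => absurd hy h
  -- Grid points with a zero coordinate lie in no half-open box, so their weights do not matter.
  · rw [Set.indicator_of_notMem, mul_zero]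
    exact fun h => hpos fun i => bot_le.trans_lt ((mem_box.1 h i).1)

/-- The boxes of a grid are labelled by their upper corners, which are the grid points without zero
coordinate. -/
theorem sum_cells_le_vitaliVariation {F : Finset unitInterval} (h0 : 0 ∈ F) (h1 : 1 ∈ F)
    (g : Cube ι → ℝ) :
    ∑ y ∈ gridPts ι F with ∀ i, 0 < y i,
      ENNReal.ofReal |quasiVolume g (fun i => pred F (y i)) y| ≤ vitaliVariation g := by
  obtain ⟨P, hP⟩ := exists_unitPartition F h0 h1
  refine le_trans ?_ (le_iSup _ fun _ : ι => P)
  have hinj : Function.Injective fun (l : ι → Fin P.m) (i : ι) => P.pt (l i).succ := by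
    intro l l' h
    funext i
    exact Fin.succ_injective _ (P.strictMono.injective (congrFun h i))
  have hsub : (gridPts ι F).filter (fun y => ∀ i, 0 < y i) ⊆
      Finset.univ.image fun (l : ι → Fin P.m) (i : ι) => P.pt (l i).succ := by
    intro y hy
    rw [Finset.mem_filter, mem_gridPts] at hy
    have : ∀ i, ∃ l : Fin P.m, P.pt l.succ = y i := by
      intro i
      have h := hy.1 i
      rw [← Finset.mem_coe, ← hP] at h
      obtain ⟨k, hk⟩ := h
      have hk0 : k ≠ 0 := by
        rintro rfl
        exact (hy.2 i).ne (P.pt_zero.symm.trans hk)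
      obtain ⟨l, rfl⟩ := Fin.exists_succ_eq.2 hk0
      exact ⟨l, hk⟩
    choose l hl using this
    exact Finset.mem_image.2 ⟨l, Finset.mem_univ _, funext hl⟩
  refine (Finset.sum_le_sum_of_subset hsub).trans ?_
  rw [Finset.sum_image fun _ _ _ _ h => hinj h]
  simp only [UnitPartition.pred_pt_succ hP]
  exact le_rfl

/-- Finitely many points have their coordinates in a common grid. -/
theorem exists_grid {ι : Type*} [Fintype ι] (A : Finset (Cube ι)) :
    ∃ F : Finset unitInterval, 0 ∈ F ∧ 1 ∈ F ∧ ∀ a ∈ A, ∀ i, a i ∈ F := by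
  classical
  refine ⟨insert 0 (insert 1 (A.biUnion fun a => Finset.univ.image a)), by simp, by simp, ?_⟩
  intro a ha i
  simp only [Finset.mem_insert, Finset.mem_biUnion]
  exact Or.inr (Or.inr ⟨a, ha, Finset.mem_image_of_mem _ (Finset.mem_univ i)⟩)

theorem sum_indicator_le_one {κ α : Type*} (K : Finset κ) (B : κ → Set α)
    (h : (K : Set κ).PairwiseDisjoint B) (y : α) :
    ∑ k ∈ K, (B k).indicator (1 : α → ℝ) y ≤ 1 := by
  classical
  by_cases hy : ∃ k ∈ K, y ∈ B k
  · obtain ⟨k, hk, hyk⟩ := hy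
    rw [Finset.sum_eq_single_of_mem k hk, Set.indicator_of_mem hyk, Pi.one_apply]
    intro j hj hjk
    exact Set.indicator_of_notMem (fun hyj => Set.disjoint_left.1 (h hj hk hjk) hyj hyk) _
  · rw [Finset.sum_eq_zero fun k hk => Set.indicator_of_notMem (fun h => hy ⟨k, hk, h⟩) _]
    exact zero_le_one

/-- The Vitali variation bounds the sum over any finite family of disjoint boxes, which need not
come from a grid. -/
theorem sum_le_vitaliVariation (g : Cube ι → ℝ) {κ : Type*} (K : Finset κ) (a b : κ → Cube ι)
    (hab : ∀ k ∈ K, a k ≤ b k)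
    (hdisj : (K : Set κ).PairwiseDisjoint fun k => box (a k) (b k)) :
    ∑ k ∈ K, ENNReal.ofReal |quasiVolume g (a k) (b k)| ≤ vitaliVariation g := by
  classical
  obtain ⟨F, h0, h1, hF⟩ := exists_grid (K.image a ∪ K.image b)
  refine le_trans ?_ (sum_cells_le_vitaliVariation h0 h1 g)
  rw [← ENNReal.ofReal_sum_of_nonneg fun _ _ => abs_nonneg _,
    ← ENNReal.ofReal_sum_of_nonneg fun _ _ => abs_nonneg _]
  refine ENNReal.ofReal_le_ofReal ?_
  calc ∑ k ∈ K, |quasiVolume g (a k) (b k)|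
      ≤ ∑ k ∈ K, ∑ y ∈ gridPts ι F with ∀ i, 0 < y i,
        |quasiVolume g (fun i => pred F (y i)) y| * (box (a k) (b k)).indicator 1 y := by
        refine Finset.sum_le_sum fun k hk => ?_
        rw [quasiVolume_eq_sum_cells h0 g (hab k hk)
          (mem_gridPts.2 (hF _ (by simp [Finset.mem_image_of_mem a hk])))
          (mem_gridPts.2 (hF _ (by simp [Finset.mem_image_of_mem b hk])))]
        refine (Finset.abs_sum_le_sum_abs _ _).trans (Finset.sum_le_sum fun y _ => ?_)
        rw [abs_mul, abs_of_nonneg (a := Set.indicator _ _ _)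
          (Set.indicator_nonneg (by simp) _)]
    _ ≤ _ := by
        rw [Finset.sum_comm]
        refine Finset.sum_le_sum fun y _ => ?_
        rw [← Finset.mul_sum]
        exact mul_le_of_le_one_right (abs_nonneg _) (sum_indicator_le_one K _ hdisj y)

theorem UnitPartition.pt_eq_of_mem {P : UnitPartition} {j k : Fin P.m} {t : unitInterval}
    (hj : P.pt j.castSucc < t ∧ t ≤ P.pt j.succ) (hk : P.pt k.castSucc < t ∧ t ≤ P.pt k.succ) :
    j = k := by
  have h1 := P.strictMono.lt_iff_lt.1 (hj.1.trans_le hk.2)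
  have h2 := P.strictMono.lt_iff_lt.1 (hk.1.trans_le hj.2)
  rw [Fin.castSucc_lt_succ_iff] at h1 h2
  exact le_antisymm h1 h2

/-- A point lies in at most one half-open box of a grid. -/
theorem eq_of_forall_mem_Ioc {ι : Type*} (P : ι → UnitPartition) {l l' : ∀ i, Fin (P i).m}
    {t : Cube ι}
    (h : ∀ i, (P i).pt (l i).castSucc < t i ∧ t i ≤ (P i).pt (l i).succ)
    (h' : ∀ i, (P i).pt (l' i).castSucc < t i ∧ t i ≤ (P i).pt (l' i).succ) : l = l' :=
  funext fun i => UnitPartition.pt_eq_of_mem (h i) (h' i)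

/-- If the quasi-volumes generated by `g` are bounded by those generated by `h`, the Vitali
variation of `g` is at most the quasi-volume of the whole cube generated by `h`. -/
theorem vitaliVariation_le_of_dominated {g h : Cube ι → ℝ}
    (H : ∀ a b : Cube ι, a ≤ b → |quasiVolume g a b| ≤ quasiVolume h a b) :
    vitaliVariation g ≤ ENNReal.ofReal (quasiVolume h 0 1) := by
  classical
  have hnn : ∀ a b : Cube ι, a ≤ b → 0 ≤ quasiVolume h a b := fun a b hab =>
    (abs_nonneg _).trans (H a b hab)
  refine iSup_le fun P => ?_
  set a : (∀ i, Fin (P i).m) → Cube ι := fun l i => (P i).pt (l i).castSucc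
  set b : (∀ i, Fin (P i).m) → Cube ι := fun l i => (P i).pt (l i).succ
  have hab : ∀ l, a l ≤ b l := fun l i => (P i).strictMono.monotone Fin.castSucc_lt_succ.le
  have hdisj : ((Finset.univ : Finset (∀ i, Fin (P i).m)) : Set _).PairwiseDisjoint
      fun l => box (a l) (b l) := by
    intro l _ l' _ hne
    refine Set.disjoint_left.2 fun z hz hz' => hne ?_
    exact eq_of_forall_mem_Ioc P (mem_box.1 hz) (mem_box.1 hz')
  obtain ⟨F, h0, h1, hF⟩ := exists_grid (Finset.univ.image a ∪ Finset.univ.image b)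
  rw [← ENNReal.ofReal_sum_of_nonneg fun _ _ => abs_nonneg _]
  refine ENNReal.ofReal_le_ofReal ?_
  calc ∑ l, |quasiVolume g (a l) (b l)| ≤ ∑ l, quasiVolume h (a l) (b l) :=
        Finset.sum_le_sum fun l _ => H _ _ (hab l)
    _ = ∑ l, ∑ y ∈ gridPts ι F with ∀ i, 0 < y i,
        quasiVolume h (fun i => pred F (y i)) y * (box (a l) (b l)).indicator 1 y :=
        Finset.sum_congr rfl fun l _ => quasiVolume_eq_sum_cells h0 h (hab l)
          (mem_gridPts.2 (hF _ (by simp))) (mem_gridPts.2 (hF _ (by simp)))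
    _ ≤ ∑ y ∈ gridPts ι F with ∀ i, 0 < y i, quasiVolume h (fun i => pred F (y i)) y := by
        rw [Finset.sum_comm]
        refine Finset.sum_le_sum fun y _ => ?_
        rw [← Finset.mul_sum]
        exact mul_le_of_le_one_right (hnn _ _ fun i => pred_le F _)
          (sum_indicator_le_one _ _ hdisj y)
    _ = quasiVolume h 0 1 := by
        rw [quasiVolume_eq_sum_cells h0 h zero_le_one (mem_gridPts.2 fun _ => h0)
          (mem_gridPts.2 fun _ => h1)]
        refine Finset.sum_congr rfl fun y hy => ?_
        rw [Set.indicator_of_mem, Pi.one_apply, mul_one]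
        exact mem_box.2 fun i => ⟨(Finset.mem_filter.1 hy).2 i, le_top⟩

end Grid

/-! ### Grid weights on the faces of the cube -/

section FaceWeights

variable {d : ℕ}

/-- The set of non-zero coordinates of a point. -/
noncomputable def supp (z : Cube (Fin d)) : Finset (Fin d) := Finset.univ.filter fun i => 0 < z i

theorem mem_supp {z : Cube (Fin d)} {i : Fin d} : i ∈ supp z ↔ 0 < z i := by simp [supp]

theorem notMem_supp {z : Cube (Fin d)} {i : Fin d} : i ∉ supp z ↔ z i = 0 := by
  rw [mem_supp, not_lt]
  exact le_bot_iff

theorem supp_eq_empty {z : Cube (Fin d)} : supp z = ∅ ↔ z = 0 := by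
  rw [Finset.eq_empty_iff_forall_notMem, funext_iff]
  simp only [notMem_supp, Pi.zero_apply]

/-- The quasi-volume of a box with grid corners in a face, in terms of the grid weights. -/
theorem quasiVolume_face_eq_sum_weight {F : Finset unitInterval} {f w : Cube (Fin d) → ℝ}
    (hw : ∀ x ∈ gridPts (Fin d) F, f x = ∑ z ∈ gridPts (Fin d) F, w z * step z x)
    {S : Finset (Fin d)} {c : Cube (Fin d)} {a b : Cube S} (hab : a ≤ b)
    (hc : ∀ i, c i ∈ F) (ha : ∀ i, a i ∈ F) (hb : ∀ i, b i ∈ F) :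
    quasiVolume (fun y => f (face S c y)) a b =
      ∑ z ∈ gridPts (Fin d) F, w z * (cell S c a b).indicator 1 z := by
  rw [quasiVolume_congr
    (h := fun y => ∑ z ∈ gridPts (Fin d) F, w z * step z (face S c y)), quasiVolume_sum]
  · simp only [quasiVolume_const_mul, quasiVolume_step_face _ _ _ hab]
  · refine fun y hy => hw _ (mem_gridPts.2 fun i => ?_)
    by_cases hi : i ∈ S
    · rcases hy ⟨i, hi⟩ with h | h <;> simp [face, hi, h, ha, hb]
    · simp [face, hi, hc]

theorem mem_cell_pred_iff {F : Finset unitInterval} {y z : Cube (Fin d)}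
    (hz : z ∈ gridPts (Fin d) F) :
    z ∈ cell (supp y) 0 (fun i => pred F (y i)) (fun i => y i) ↔ z = y := by
  constructor
  · rintro ⟨h1, h2⟩
    funext i
    by_cases hi : i ∈ supp y
    · by_contra hne
      have h := h1 ⟨i, hi⟩
      exact (h.1.trans_le (le_pred (mem_gridPts.1 hz i) (lt_of_le_of_ne h.2 hne))).false
    · rw [notMem_supp.1 hi]
      exact le_bot_iff.1 (h2 i hi)
  · rintro rfl
    exact ⟨fun i => ⟨pred_lt (mem_supp.1 i.2), le_rfl⟩, fun i hi => (notMem_supp.1 hi).le⟩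

/-- The weight of a grid point is the quasi-volume of the box, in the smallest face through `0`
containing the point, that has this point as its upper corner. -/
theorem weight_eq_quasiVolume {F : Finset unitInterval} (h0 : 0 ∈ F) {f w : Cube (Fin d) → ℝ}
    (hw : ∀ x ∈ gridPts (Fin d) F, f x = ∑ z ∈ gridPts (Fin d) F, w z * step z x)
    {y : Cube (Fin d)} (hy : y ∈ gridPts (Fin d) F) :
    w y = quasiVolume (fun u => f (face (supp y) 0 u)) (fun i => pred F (y i)) fun i => y i := by
  rw [quasiVolume_face_eq_sum_weight (c := 0) hw (fun i => pred_le F (y i)) (fun _ => h0)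
    (fun _ => pred_mem h0 _) (fun i => mem_gridPts.1 hy i), Finset.sum_eq_single y]
  · rw [Set.indicator_of_mem ((mem_cell_pred_iff hy).2 rfl)]
    simp
  · intro z hz hzy
    rw [Set.indicator_of_notMem (mt (mem_cell_pred_iff hz).1 hzy), mul_zero]
  · exact fun h => absurd hy h

theorem weight_zero {F : Finset unitInterval} (h0 : 0 ∈ F) {f w : Cube (Fin d) → ℝ}
    (hw : ∀ x ∈ gridPts (Fin d) F, f x = ∑ z ∈ gridPts (Fin d) F, w z * step z x) :
    w 0 = f 0 := by
  have h0' : (0 : Cube (Fin d)) ∈ gridPts (Fin d) F := mem_gridPts.2 fun _ => h0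
  rw [hw 0 h0', Finset.sum_eq_single_of_mem 0 h0', step_of_le le_rfl, mul_one]
  intro z _ hz
  rw [step_of_not_le fun h => hz (le_antisymm h fun _ => bot_le), mul_zero]

/-- The weights of the grid points inside a given face through `0` belong to disjoint boxes of this
face, so they are controlled by its Vitali variation. -/
theorem sum_weight_supp_le {F : Finset unitInterval} (h0 : 0 ∈ F) {f w : Cube (Fin d) → ℝ}
    (hw : ∀ x ∈ gridPts (Fin d) F, f x = ∑ z ∈ gridPts (Fin d) F, w z * step z x)
    (S : Finset (Fin d)) :
    ∑ z ∈ gridPts (Fin d) F with supp z = S, ENNReal.ofReal |w z| ≤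
      vitaliVariation fun y : Cube S => f (face S 0 y) := by
  have e : ∀ z ∈ (gridPts (Fin d) F).filter (fun z => supp z = S), ENNReal.ofReal |w z| =
      ENNReal.ofReal |quasiVolume (fun y : Cube S => f (face S 0 y))
        (fun i => pred F (z i)) (fun i => z i)| := by
    intro z hz
    obtain ⟨hzF, rfl⟩ := Finset.mem_filter.1 hz
    rw [weight_eq_quasiVolume h0 hw hzF]
  rw [Finset.sum_congr rfl e]
  apply sum_le_vitaliVariation (fun y : Cube S => f (face S 0 y))
    ((gridPts (Fin d) F).filter fun z => supp z = S)
    (fun z i => pred F (z i)) (fun z i => z i) (fun z _ i => pred_le F _)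
  intro z hz z' hz' hne
  refine Set.disjoint_left.2 fun t ht ht' => ?_
  simp only [Finset.coe_filter, Set.mem_ofPred_eq, mem_gridPts] at hz hz'
  refine hne (funext fun i => ?_)
  by_cases hi : i ∈ S
  · have h1 := mem_box.1 ht ⟨i, hi⟩
    have h2 := mem_box.1 ht' ⟨i, hi⟩
    rcases lt_trichotomy (z i) (z' i) with h | h | h
    · exact absurd (h1.2.trans (le_pred (hz.1 i) h)) h2.1.not_ge
    · exact h
    · exact absurd (h2.2.trans (le_pred (hz'.1 i) h)) h1.1.not_ge
  · have e1 : i ∉ supp z := hz.2 ▸ hi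
    have e2 : i ∉ supp z' := hz'.2 ▸ hi
    rw [notMem_supp.1 e1, notMem_supp.1 e2]

/-- The total mass of the discrete measure representing `f` on a grid is at most the HK0-variation
plus the mass at the origin. -/
theorem sum_weight_le {F : Finset unitInterval} (h0 : 0 ∈ F) {f w : Cube (Fin d) → ℝ}
    (hw : ∀ x ∈ gridPts (Fin d) F, f x = ∑ z ∈ gridPts (Fin d) F, w z * step z x) :
    ∑ z ∈ gridPts (Fin d) F, ENNReal.ofReal |w z| ≤ varHK0 f + ENNReal.ofReal |f 0| := by
  rw [← Finset.sum_fiberwise (gridPts (Fin d) F) supp,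
    ← Finset.sum_filter_add_sum_filter_not _ (fun S : Finset (Fin d) => S.Nonempty)]
  refine add_le_add (Finset.sum_le_sum fun S _ => sum_weight_supp_le h0 hw S) ?_
  · have : (Finset.univ.filter fun S : Finset (Fin d) => ¬ S.Nonempty) = {∅} := by
      ext S
      simp [Finset.not_nonempty_iff_eq_empty]
    rw [this, Finset.sum_singleton]
    have h0' : (0 : Cube (Fin d)) ∈ gridPts (Fin d) F := mem_gridPts.2 fun _ => h0
    have : (gridPts (Fin d) F).filter (fun z => supp z = ∅) = {0} := by
      ext z
      simp only [supp_eq_empty, Finset.mem_filter, Finset.mem_singleton]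
      exact ⟨fun h => h.2, fun h => ⟨h ▸ h0', h⟩⟩
    rw [this, Finset.sum_singleton, weight_zero h0 hw]

/-- The half-open faces through `0` partition the cube according to the non-zero coordinates. -/
theorem mem_cell_zero_one {S : Finset (Fin d)} {z : Cube (Fin d)} :
    z ∈ cell S 0 0 1 ↔ supp z = S := by
  constructor
  · rintro ⟨h1, h2⟩
    ext i
    rw [mem_supp]
    refine ⟨fun h => ?_, fun h => (h1 ⟨i, h⟩).1⟩
    by_contra hi
    exact (h.trans_le (h2 i hi)).false
  · rintro rfl
    exact ⟨fun i => ⟨mem_supp.1 i.2, le_top⟩, fun i hi => (notMem_supp.1 hi).le⟩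

/-- The quasi-volumes of all the faces of positive dimension through `0` add up to the increment
over the cube. -/
theorem sum_quasiVolume_face (h : Cube (Fin d) → ℝ) :
    ∑ S : Finset (Fin d) with S.Nonempty, quasiVolume (fun y : Cube S => h (face S 0 y)) 0 1 =
      h 1 - h 0 := by
  classical
  set F : Finset unitInterval := {0, 1}
  have h0 : (0 : unitInterval) ∈ F := by simp [F]
  have h1 : (1 : unitInterval) ∈ F := by simp [F]
  obtain ⟨w, hw⟩ := exists_grid_weight F h
  have e : ∀ S : Finset (Fin d), quasiVolume (fun y : Cube S => h (face S 0 y)) 0 1 =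
      ∑ z ∈ gridPts (Fin d) F, w z * (cell S 0 0 1).indicator 1 z := fun S =>
    quasiVolume_face_eq_sum_weight hw zero_le_one (fun _ => h0) (fun _ => h0) (fun _ => h1)
  simp only [e]
  rw [Finset.sum_comm, hw 1 (mem_gridPts.2 fun _ => h1), hw 0 (mem_gridPts.2 fun _ => h0),
    ← Finset.sum_sub_distrib]
  refine Finset.sum_congr rfl fun z _ => ?_
  rw [← Finset.mul_sum, ← mul_sub]
  congr 1
  rw [step_of_le (x := 1) fun _ => le_top]
  by_cases hz : z = 0
  · subst hz
    rw [step_of_le le_rfl, sub_self]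
    refine Finset.sum_eq_zero fun S hS => Set.indicator_of_notMem ?_ _
    rw [mem_cell_zero_one, supp_eq_empty.2 rfl]
    exact (Finset.mem_filter.1 hS).2.ne_empty.symm
  · rw [step_of_not_le fun h => hz (le_antisymm h fun _ => bot_le), sub_zero,
      Finset.sum_eq_single_of_mem (supp z), Set.indicator_of_mem (mem_cell_zero_one.2 rfl),
      Pi.one_apply]
    · exact Finset.mem_filter.2 ⟨Finset.mem_univ _,
        Finset.nonempty_iff_ne_empty.2 fun h => hz (supp_eq_empty.1 h)⟩
    · exact fun S _ hS => Set.indicator_of_notMem (fun h => hS (mem_cell_zero_one.1 h).symm) _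

end FaceWeights

/-! ### Completely monotone functions -/

section Monotone

variable {d : ℕ}

/-- All boxes in the faces through `0` have non-negative quasi-volume. This part of complete
monotonicity is what the HK0-variation sees. Degenerate boxes are allowed: their quasi-volume is
zero. -/
def AnchoredMonotone (h : Cube (Fin d) → ℝ) : Prop :=
  ∀ (S : Finset (Fin d)), S.Nonempty → ∀ a b : Cube S, a ≤ b →
    0 ≤ quasiVolume (fun y : Cube S => h (face S 0 y)) a b

/-- The HK0-variation of a difference of two monotone functions is at most the sum of their
increments over the cube. -/
theorem varHK0_sub_le {p n : Cube (Fin d) → ℝ} (hp : AnchoredMonotone p)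
    (hn : AnchoredMonotone n) :
    varHK0 (fun x => p x - n x) ≤ ENNReal.ofReal ((p 1 + n 1) - (p 0 + n 0)) := by
  have H : ∀ S : Finset (Fin d), S.Nonempty → ∀ a b : Cube S, a ≤ b →
      |quasiVolume (fun y : Cube S => p (face S 0 y) - n (face S 0 y)) a b| ≤
        quasiVolume (fun y : Cube S => p (face S 0 y) + n (face S 0 y)) a b := by
    intro S hS a b hab
    rw [quasiVolume_sub, quasiVolume_add]
    have h1 := hp S hS a b hab
    have h2 := hn S hS a b hab
    rw [abs_le]
    constructor <;> linarith
  rw [← sum_quasiVolume_face (fun x => p x + n x), ENNReal.ofReal_sum_of_nonneg]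
  · exact Finset.sum_le_sum fun S hS =>
      vitaliVariation_le_of_dominated (H S (Finset.mem_filter.1 hS).2)
  · exact fun S hS => (abs_nonneg _).trans (H S (Finset.mem_filter.1 hS).2 0 1 zero_le_one)

theorem sub_le_varHK0 (h : Cube (Fin d) → ℝ) : ENNReal.ofReal (h 1 - h 0) ≤ varHK0 h := by
  rw [← sum_quasiVolume_face]
  calc ENNReal.ofReal (∑ S : Finset (Fin d) with S.Nonempty,
        quasiVolume (fun y : Cube S => h (face S 0 y)) 0 1)
      ≤ ENNReal.ofReal (∑ S : Finset (Fin d) with S.Nonempty,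
        |quasiVolume (fun y : Cube S => h (face S 0 y)) 0 1|) :=
        ENNReal.ofReal_le_ofReal (Finset.sum_le_sum fun _ _ => le_abs_self _)
    _ = ∑ S : Finset (Fin d) with S.Nonempty,
        ENNReal.ofReal |quasiVolume (fun y : Cube S => h (face S 0 y)) 0 1| :=
        ENNReal.ofReal_sum_of_nonneg fun _ _ => abs_nonneg _
    _ ≤ varHK0 h := by
        refine Finset.sum_le_sum fun S _ => ?_
        have := sum_le_vitaliVariation (fun y : Cube S => h (face S 0 y)) {()} (fun _ => 0)
          (fun _ => 1) (fun _ _ => zero_le_one) (by simp)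
        simpa using this

/-- On a grid a completely monotone function is the distribution function of a positive measure. -/
theorem CompletelyMonotone.weight_nonneg {h w : Cube (Fin d) → ℝ} (hh : CompletelyMonotone h)
    (hh0 : 0 ≤ h 0) {F : Finset unitInterval} (h0 : 0 ∈ F)
    (hw : ∀ x ∈ gridPts (Fin d) F, h x = ∑ z ∈ gridPts (Fin d) F, w z * step z x)
    {y : Cube (Fin d)} (hy : y ∈ gridPts (Fin d) F) : 0 ≤ w y := by
  by_cases hs : (supp y).Nonempty
  · rw [weight_eq_quasiVolume h0 hw hy]
    exact hh _ hs 0 _ _ fun i => pred_lt (mem_supp.1 i.2)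
  · rw [Finset.not_nonempty_iff_eq_empty, supp_eq_empty] at hs
    rw [hs, weight_zero h0 hw]
    exact hh0

/-- If, on grids containing the coordinates of `x`, the function `k` is obtained from `h` by
multiplying the weights by a non-negative factor, then `k` inherits the positivity of `h`. -/
theorem CompletelyMonotone.anchoredMonotone_of_weight {h k : Cube (Fin d) → ℝ}
    (hh : CompletelyMonotone h) (hh0 : 0 ≤ h 0) (x : Cube (Fin d)) (r : Cube (Fin d) → ℝ)
    (hr : ∀ z, 0 ≤ r z)
    (hk : ∀ (F : Finset unitInterval) (w : Cube (Fin d) → ℝ), (∀ i, x i ∈ F) →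
      (∀ y ∈ gridPts (Fin d) F, h y = ∑ z ∈ gridPts (Fin d) F, w z * step z y) →
      ∀ y ∈ gridPts (Fin d) F, k y = ∑ z ∈ gridPts (Fin d) F, w z * r z * step z y) :
    AnchoredMonotone k := by
  classical
  intro S _ a b hab
  obtain ⟨F, h0, -, hF⟩ := exists_grid {x, face S 0 a, face S 0 b}
  have hx : ∀ i, x i ∈ F := hF x (by simp)
  have ha : ∀ i, a i ∈ F := fun i => by simpa [face] using hF (face S 0 a) (by simp) i
  have hb : ∀ i, b i ∈ F := fun i => by simpa [face] using hF (face S 0 b) (by simp) i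
  obtain ⟨w, hw⟩ := exists_grid_weight F h
  rw [quasiVolume_face_eq_sum_weight (c := 0) (w := fun z => w z * r z) (hk F w hx hw) hab
    (fun _ => h0) ha hb]
  exact Finset.sum_nonneg fun z hz =>
    mul_nonneg (mul_nonneg (hh.weight_nonneg hh0 h0 hw hz) (hr z))
      (Set.indicator_nonneg (by simp) _)

theorem inf_mem_gridPts {F : Finset unitInterval} {x y : Cube (Fin d)}
    (hx : ∀ i, x i ∈ F) (hy : y ∈ gridPts (Fin d) F) : y ⊓ x ∈ gridPts (Fin d) F := by
  refine mem_gridPts.2 fun i => ?_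
  rcases min_choice (y i) (x i) with h | h
  · exact (show (y ⊓ x) i = y i from h) ▸ mem_gridPts.1 hy i
  · exact (show (y ⊓ x) i = x i from h) ▸ hx i

/-- Restriction of a positive measure to `[0, x]`, in terms of distribution functions. -/
theorem CompletelyMonotone.anchoredMonotone_inf {h : Cube (Fin d) → ℝ}
    (hh : CompletelyMonotone h) (hh0 : 0 ≤ h 0) (x : Cube (Fin d)) :
    AnchoredMonotone fun y => h (y ⊓ x) := by
  refine hh.anchoredMonotone_of_weight hh0 x (fun z => step z x) (fun z => step_nonneg z x) ?_
  intro F w hx hw y hy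
  rw [hw _ (inf_mem_gridPts hx hy)]
  exact Finset.sum_congr rfl fun z _ => by rw [step_inf]; ring

/-- Restriction of a positive measure to the complement of `[0, x]`, in terms of distribution
functions. -/
theorem CompletelyMonotone.anchoredMonotone_sub_inf {h : Cube (Fin d) → ℝ}
    (hh : CompletelyMonotone h) (hh0 : 0 ≤ h 0) (x : Cube (Fin d)) :
    AnchoredMonotone fun y => h y - h (y ⊓ x) := by
  refine hh.anchoredMonotone_of_weight hh0 x (fun z => 1 - step z x)
    (fun z => sub_nonneg.2 (step_le_one z x)) ?_
  intro F w hx hw y hy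
  rw [hw _ (inf_mem_gridPts hx hy), hw y hy, ← Finset.sum_sub_distrib]
  exact Finset.sum_congr rfl fun z _ => by rw [step_inf]; ring

end Monotone

/-! ### Change of the anchor -/

section Anchor

variable {d : ℕ}

/-- Inclusion–exclusion: a box in a face through `0` is expressed by boxes in faces through `1`,
which extend over the whole unit interval in the additional coordinates. -/
theorem indicator_cell_zero_eq_sum (S : Finset (Fin d)) (a b : Cube S) (z : Cube (Fin d)) :
    (cell S 0 a b).indicator (1 : Cube (Fin d) → ℝ) z = ∑ U ∈ Sᶜ.powerset, (-1 : ℝ) ^ U.card *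
      (cell (S ∪ U) 1 (fun i => face S 0 a i) (fun i => face S 1 b i)).indicator 1 z := by
  classical
  by_cases hz : ∀ i : S, a i < z i ∧ z i ≤ b i
  · have key : ∀ U ∈ Sᶜ.powerset,
        (z ∈ cell (S ∪ U) 1 (fun i => face S 0 a i) (fun i => face S 1 b i) ↔ U ⊆ supp z) := by
      intro U hU
      rw [Finset.mem_powerset] at hU
      constructor
      · rintro ⟨h, -⟩ i hi
        have := (h ⟨i, Finset.mem_union_right _ hi⟩).1
        have hiS : i ∉ S := Finset.mem_compl.1 (hU hi)
        rw [mem_supp]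
        simpa [face, hiS] using this
      · intro h
        refine ⟨fun i => ?_, fun _ _ => le_top⟩
        by_cases hiS : (i : Fin d) ∈ S
        · simpa [face, hiS] using hz ⟨i, hiS⟩
        · have hiU : (i : Fin d) ∈ U := (Finset.mem_union.1 i.2).resolve_left hiS
          have := mem_supp.1 (h hiU)
          simpa [face, hiS] using ⟨this, le_top⟩
    -- Only the subsets `U` of `Sᶜ ∩ supp z` contribute, and their signs cancel unless this set
    -- is empty, that is, unless `z` lies on the face through `0`.
    have e : ∑ U ∈ Sᶜ.powerset, (-1 : ℝ) ^ U.card *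
        (cell (S ∪ U) 1 (fun i => face S 0 a i) (fun i => face S 1 b i)).indicator 1 z =
        ∑ U ∈ (Sᶜ ∩ supp z).powerset, (-1 : ℝ) ^ U.card := by
      have : (Sᶜ ∩ supp z).powerset = Sᶜ.powerset.filter (· ⊆ supp z) := by
        ext U
        rw [Finset.mem_powerset, Finset.mem_filter, Finset.mem_powerset, Finset.subset_inter_iff]
      rw [this, Finset.sum_filter]
      refine Finset.sum_congr rfl fun U hU => ?_
      split_ifs with h
      · rw [Set.indicator_of_mem ((key U hU).2 h), Pi.one_apply, mul_one]
      · rw [Set.indicator_of_notMem (mt (key U hU).1 h), mul_zero]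
    have e2 : ∑ U ∈ (Sᶜ ∩ supp z).powerset, (-1 : ℝ) ^ U.card =
        if Sᶜ ∩ supp z = ∅ then 1 else 0 := by
      exact_mod_cast congrArg (Int.cast : ℤ → ℝ) (Finset.sum_powerset_neg_one_pow_card)
    rw [e, e2]
    split_ifs with h
    · refine Set.indicator_of_mem (show z ∈ cell S 0 a b from ⟨hz, fun i hi => ?_⟩) _
      have : i ∉ supp z := fun h' => by
        have h'' : i ∈ Sᶜ ∩ supp z := by simp [hi, h']
        rw [h] at h''
        simp at h''
      exact (notMem_supp.1 this).le
    · refine Set.indicator_of_notMem (fun hc => h ?_) _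
      rw [Finset.eq_empty_iff_forall_notMem]
      intro i hi
      rw [Finset.mem_inter, Finset.mem_compl, mem_supp] at hi
      exact (hi.2.trans_le (hc.2 i hi.1)).false
  · rw [Set.indicator_of_notMem fun h : z ∈ cell S 0 a b => hz h.1, Finset.sum_eq_zero]
    intro U _
    rw [Set.indicator_of_notMem, mul_zero]
    rintro ⟨h, -⟩
    refine hz fun i => ?_
    simpa [face] using h ⟨i, Finset.mem_union_left _ i.2⟩

theorem quasiVolume_face_zero_eq_sum (f : Cube (Fin d) → ℝ) (S : Finset (Fin d)) {a b : Cube S}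
    (hab : a ≤ b) :
    quasiVolume (fun y : Cube S => f (face S 0 y)) a b = ∑ U ∈ Sᶜ.powerset, (-1 : ℝ) ^ U.card *
      quasiVolume (fun y : Cube (S ∪ U : Finset (Fin d)) => f (face (S ∪ U) 1 y))
        (fun i => face S 0 a i) (fun i => face S 1 b i) := by
  classical
  obtain ⟨F, h0, h1, hF⟩ := exists_grid {face S 0 a, face S 1 b}
  have ha : ∀ i, face S 0 a i ∈ F := hF _ (by simp)
  have hb : ∀ i, face S 1 b i ∈ F := hF _ (by simp)
  have hle : ∀ i, face S 0 a i ≤ face S 1 b i := by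
    intro i
    by_cases hi : i ∈ S
    · simpa [face, hi] using hab ⟨i, hi⟩
    · simp [face, hi]
  obtain ⟨w, hw⟩ := exists_grid_weight F f
  rw [quasiVolume_face_eq_sum_weight (c := 0) hw hab (fun _ => h0)
    (fun i => by simpa [face] using ha i)
    (fun i => by simpa [face] using hb i)]
  have e : ∀ U ∈ Sᶜ.powerset, (-1 : ℝ) ^ U.card *
      quasiVolume (fun y : Cube (S ∪ U : Finset (Fin d)) => f (face (S ∪ U) 1 y))
        (fun i => face S 0 a i) (fun i => face S 1 b i) =
      ∑ z ∈ gridPts (Fin d) F, (-1 : ℝ) ^ U.card * (w z *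
        (cell (S ∪ U) 1 (fun i => face S 0 a i) (fun i => face S 1 b i)).indicator 1 z) := by
    intro U _
    rw [quasiVolume_face_eq_sum_weight (c := 1) hw (fun i => hle i) (fun _ => h1) (fun i => ha i)
      (fun i => hb i), Finset.mul_sum]
  rw [Finset.sum_congr rfl e, Finset.sum_comm]
  refine Finset.sum_congr rfl fun z _ => ?_
  rw [indicator_cell_zero_eq_sum, Finset.mul_sum]
  exact Finset.sum_congr rfl fun U _ => by ring

/-- A function of bounded variation in the sense of Hardy and Krause anchored at `1` also has
bounded variation anchored at `0`. -/
theorem BoundedHK.varHK0_lt_top {f : Cube (Fin d) → ℝ} (hf : BoundedHK f) : varHK0 f < ∞ := by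
  classical
  have hfin : ∀ S : Finset (Fin d), S.Nonempty →
      vitaliVariation (fun y : Cube S => f (face S 1 y)) < ∞ := fun S hS =>
    lt_of_le_of_lt (Finset.single_le_sum
      (f := fun S : Finset (Fin d) => vitaliVariation fun y : Cube S => f (face S 1 y))
      (fun _ _ => zero_le) (Finset.mem_filter.2 ⟨Finset.mem_univ S, hS⟩)) hf
  rw [varHK0, anchoredVariation]
  refine ENNReal.sum_lt_top.2 fun S hS => ?_
  have hS := (Finset.mem_filter.1 hS).2
  refine lt_of_le_of_lt (b := ∑ U ∈ Sᶜ.powerset,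
    vitaliVariation fun y : Cube (S ∪ U : Finset (Fin d)) => f (face (S ∪ U) 1 y)) ?_
    (ENNReal.sum_lt_top.2 fun U _ => hfin _ (hS.mono Finset.subset_union_left))
  refine iSup_le fun P => ?_
  set a : (∀ i, Fin (P i).m) → Cube S := fun l i => (P i).pt (l i).castSucc
  set b : (∀ i, Fin (P i).m) → Cube S := fun l i => (P i).pt (l i).succ
  have hab : ∀ l, a l ≤ b l := fun l i => (P i).strictMono.monotone Fin.castSucc_lt_succ.le
  calc ∑ l, ENNReal.ofReal |quasiVolume (fun y : Cube S => f (face S 0 y)) (a l) (b l)|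
      ≤ ∑ l, ∑ U ∈ Sᶜ.powerset, ENNReal.ofReal
        |quasiVolume (fun y : Cube (S ∪ U : Finset (Fin d)) => f (face (S ∪ U) 1 y))
          (fun i => face S 0 (a l) i) (fun i => face S 1 (b l) i)| := by
        refine Finset.sum_le_sum fun l _ => ?_
        rw [← ENNReal.ofReal_sum_of_nonneg fun _ _ => abs_nonneg _,
          quasiVolume_face_zero_eq_sum f S (hab l)]
        refine ENNReal.ofReal_le_ofReal ((Finset.abs_sum_le_sum_abs _ _).trans ?_)
        exact Finset.sum_le_sum fun U _ => by simp [abs_mul]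
    _ ≤ _ := by
        rw [Finset.sum_comm]
        refine Finset.sum_le_sum fun U _ => ?_
        refine sum_le_vitaliVariation
          (fun y : Cube (S ∪ U : Finset (Fin d)) => f (face (S ∪ U) 1 y)) _
          (fun l i => face S 0 (a l) i) (fun l i => face S 1 (b l) i) (fun l _ i => ?_) ?_
        · by_cases hi : (i : Fin d) ∈ S
          · simpa [face, hi] using hab l ⟨i, hi⟩
          · simp [face, hi]
        · intro l _ l' _ hne
          refine Set.disjoint_left.2 fun t ht ht' => hne ?_
          have key : ∀ l, t ∈ box (fun i : (S ∪ U : Finset (Fin d)) => face S 0 (a l) i)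
              (fun i => face S 1 (b l) i) → ∀ i : S,
              (P i).pt (l i).castSucc < t ⟨i, Finset.mem_union_left _ i.2⟩ ∧
              t ⟨i, Finset.mem_union_left _ i.2⟩ ≤ (P i).pt (l i).succ := by
            intro l h i
            simpa [face, a, b] using mem_box.1 h ⟨i, Finset.mem_union_left _ i.2⟩
          exact eq_of_forall_mem_Ioc P (t := fun i => t ⟨i, Finset.mem_union_left _ i.2⟩)
            (key l ht) (key l' ht')

end Anchor

/-! ### Distribution functions of measures -/

section Distr

variable {d : ℕ}

/-- The distribution function `x ↦ μ [0, x]` of a finite measure on the cube. -/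
noncomputable def distr (μ : Measure (Cube (Fin d))) (x : Cube (Fin d)) : ℝ :=
  μ.real (Set.Icc 0 x)

theorem Icc_zero_eq_Iic (x : Cube (Fin d)) : Set.Icc 0 x = Set.Iic x := by
  ext z
  exact ⟨fun h => h.2, fun h => ⟨fun _ => bot_le, h⟩⟩

theorem step_eq_indicator_Iic (x : Cube (Fin d)) :
    (fun z => step z x) = (Set.Iic x).indicator 1 := by
  funext z
  by_cases h : z ≤ x
  · rw [step_of_le h, Set.indicator_of_mem (Set.mem_Iic.2 h), Pi.one_apply]
  · rw [step_of_not_le h, Set.indicator_of_notMem (mt Set.mem_Iic.1 h)]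

theorem measurable_step (x : Cube (Fin d)) : Measurable fun z => step z x := by
  rw [step_eq_indicator_Iic]
  exact measurable_one.indicator measurableSet_Iic

theorem distr_eq_integral (μ : Measure (Cube (Fin d))) (x : Cube (Fin d)) :
    distr μ x = ∫ z, step z x ∂μ := by
  rw [step_eq_indicator_Iic, integral_indicator_one measurableSet_Iic, distr, Icc_zero_eq_Iic]

theorem integrable_step (μ : Measure (Cube (Fin d))) [IsFiniteMeasure μ] (x : Cube (Fin d)) :
    Integrable (fun z => step z x) μ := by
  rw [step_eq_indicator_Iic]
  exact (integrable_const (1 : ℝ)).indicator measurableSet_Iic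

theorem distr_zero (μ : Measure (Cube (Fin d))) : distr μ 0 = μ.real {0} := by
  rw [distr, Set.Icc_self]

theorem distr_add (μ ν : Measure (Cube (Fin d))) [IsFiniteMeasure μ] [IsFiniteMeasure ν]
    (x : Cube (Fin d)) : distr (μ + ν) x = distr μ x + distr ν x :=
  measureReal_add_apply

theorem distr_nonneg (μ : Measure (Cube (Fin d))) (x : Cube (Fin d)) : 0 ≤ distr μ x :=
  measureReal_nonneg

theorem measurableSet_cell (S : Finset (Fin d)) (c : Cube (Fin d)) (a b : Cube S) :
    MeasurableSet (cell S c a b) := by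
  have : cell S c a b = (⋂ i : S, (fun z : Cube (Fin d) => z i) ⁻¹' Set.Ioc (a i) (b i)) ∩
      ⋂ i ∈ {i : Fin d | i ∉ S}, (fun z : Cube (Fin d) => z i) ⁻¹' Set.Iic (c i) := by
    ext z
    simp [cell]
  rw [this]
  exact (MeasurableSet.iInter fun i => measurable_pi_apply _ measurableSet_Ioc).inter
    (MeasurableSet.biInter (Set.to_countable _) fun i _ => measurable_pi_apply _ measurableSet_Iic)

/-- The quasi-volume generated by a distribution function is the mass of a cell. -/
theorem quasiVolume_distr (μ : Measure (Cube (Fin d))) [IsFiniteMeasure μ] (S : Finset (Fin d))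
    (c : Cube (Fin d)) {a b : Cube S} (hab : a ≤ b) :
    quasiVolume (fun y => distr μ (face S c y)) a b = μ.real (cell S c a b) := by
  rw [← integral_indicator_one (measurableSet_cell S c a b)]
  simp only [← quasiVolume_step_face S c _ hab]
  simp only [quasiVolume, distr_eq_integral]
  rw [integral_finsetSum _ fun T _ => (integrable_step μ _).const_mul _]
  simp only [integral_const_mul]

theorem distr_completelyMonotone (μ : Measure (Cube (Fin d))) [IsFiniteMeasure μ] :
    CompletelyMonotone (distr μ) := by
  intro S _ c a b hab
  rw [quasiVolume_distr μ S c fun i => (hab i).le]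
  exact measureReal_nonneg

theorem ofReal_abs_quasiVolume_le (μ ν : Measure (Cube (Fin d))) [IsFiniteMeasure μ]
    [IsFiniteMeasure ν] (S : Finset (Fin d)) (c : Cube (Fin d)) {a b : Cube S} (hab : a ≤ b) :
    ENNReal.ofReal |quasiVolume (fun y => distr μ (face S c y) - distr ν (face S c y)) a b| ≤
      (μ + ν) (cell S c a b) := by
  rw [quasiVolume_sub, quasiVolume_distr μ S c hab, quasiVolume_distr ν S c hab]
  calc ENNReal.ofReal |μ.real (cell S c a b) - ν.real (cell S c a b)|
      ≤ ENNReal.ofReal ((μ + ν).real (cell S c a b)) := by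
        refine ENNReal.ofReal_le_ofReal ?_
        rw [measureReal_add_apply, abs_le]
        have h1 : 0 ≤ μ.real (cell S c a b) := measureReal_nonneg
        have h2 : 0 ≤ ν.real (cell S c a b) := measureReal_nonneg
        constructor <;> linarith
    _ = (μ + ν) (cell S c a b) := ofReal_measureReal

theorem vitaliVariation_distr_le (μ ν : Measure (Cube (Fin d))) [IsFiniteMeasure μ]
    [IsFiniteMeasure ν] (S : Finset (Fin d)) (c : Cube (Fin d)) :
    vitaliVariation (fun y : Cube S => distr μ (face S c y) - distr ν (face S c y)) ≤
      (μ + ν) (cell S c 0 1) := by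
  classical
  refine iSup_le fun P => ?_
  set a : (∀ i, Fin (P i).m) → Cube S := fun l i => (P i).pt (l i).castSucc
  set b : (∀ i, Fin (P i).m) → Cube S := fun l i => (P i).pt (l i).succ
  have hab : ∀ l, a l ≤ b l := fun l i => (P i).strictMono.monotone Fin.castSucc_lt_succ.le
  calc ∑ l, ENNReal.ofReal
        |quasiVolume (fun y => distr μ (face S c y) - distr ν (face S c y)) (a l) (b l)|
      ≤ ∑ l, (μ + ν) (cell S c (a l) (b l)) :=
        Finset.sum_le_sum fun l _ => ofReal_abs_quasiVolume_le μ ν S c (hab l)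
    _ = (μ + ν) (⋃ l ∈ Finset.univ, cell S c (a l) (b l)) := by
        refine (measure_biUnion_finset ?_ fun l _ => measurableSet_cell _ _ _ _).symm
        intro l _ l' _ hne
        refine Set.disjoint_left.2 fun z hz hz' => hne ?_
        exact eq_of_forall_mem_Ioc P (t := fun i => z i) hz.1 hz'.1
    _ ≤ (μ + ν) (cell S c 0 1) := by
        refine measure_mono (Set.iUnion₂_subset fun l _ z hz => ⟨fun i => ?_, hz.2⟩)
        exact ⟨bot_le.trans_lt (hz.1 i).1, le_top⟩

theorem boundedHK_distr (μ ν : Measure (Cube (Fin d))) [IsFiniteMeasure μ] [IsFiniteMeasure ν] :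
    BoundedHK fun x => distr μ x - distr ν x := by
  rw [BoundedHK, varHK, anchoredVariation]
  exact ENNReal.sum_lt_top.2 fun S _ =>
    (vitaliVariation_distr_le μ ν S 1).trans_lt (measure_lt_top _ _)

/-- The HK0-variation of a distribution function is at most the mass outside the origin. -/
theorem varHK0_distr_le (μ ν : Measure (Cube (Fin d))) [IsFiniteMeasure μ] [IsFiniteMeasure ν] :
    varHK0 (fun x => distr μ x - distr ν x) ≤ (μ + ν) {0}ᶜ := by
  classical
  calc varHK0 (fun x => distr μ x - distr ν x)
      ≤ ∑ S : Finset (Fin d) with S.Nonempty, (μ + ν) (cell S 0 0 1) :=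
        Finset.sum_le_sum fun S _ => vitaliVariation_distr_le μ ν S 0
    _ = (μ + ν) (⋃ S ∈ Finset.univ.filter fun S : Finset (Fin d) => S.Nonempty,
        cell S 0 0 1) := by
        refine (measure_biUnion_finset ?_ fun l _ => measurableSet_cell _ _ _ _).symm
        intro S _ S' _ hne
        refine Set.disjoint_left.2 fun z hz hz' => hne ?_
        rw [← mem_cell_zero_one.1 hz, mem_cell_zero_one.1 hz']
    _ ≤ (μ + ν) {0}ᶜ := by
        refine measure_mono (Set.iUnion₂_subset fun S hS z hz hz0 => ?_)
        rw [mem_cell_zero_one, supp_eq_empty.2 hz0] at hz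
        exact (Finset.mem_filter.1 hS).2.ne_empty hz.symm

theorem rightContinuous_distr (μ : Measure (Cube (Fin d))) [IsFiniteMeasure μ] :
    RightContinuous (distr μ) := by
  intro x i
  simp only [distr_eq_integral]
  refine continuousWithinAt_of_dominated (bound := fun _ => 1)
    (Filter.Eventually.of_forall fun t => (measurable_step _).aestronglyMeasurable)
    (Filter.Eventually.of_forall fun t => Filter.Eventually.of_forall fun z => ?_)
    (integrable_const _) (Filter.Eventually.of_forall fun z => ?_)
  · rw [Real.norm_of_nonneg (step_nonneg _ _)]
    exact step_le_one _ _
  · have hx : Function.update x i (x i) = x := Function.update_eq_self i x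
    suffices h : ∀ᶠ t in nhdsWithin (x i) (Set.Ici (x i)),
        step z (Function.update x i t) = step z x by
      refine (continuousWithinAt_const (b := step z x)).congr_of_eventuallyEq h ?_
      rw [hx]
    by_cases hz : z ≤ x
    · filter_upwards [self_mem_nhdsWithin] with t ht
      rw [step_of_le hz, step_of_le]
      exact hz.trans (le_update_iff.2 ⟨ht, fun _ _ => le_rfl⟩)
    · obtain ⟨j, hj⟩ := not_forall.1 hz
      by_cases hji : j = i
      · subst hji
        filter_upwards [mem_nhdsWithin_of_mem_nhds (Iio_mem_nhds (not_le.1 hj))] with t ht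
        rw [step_of_not_le hz, step_of_not_le]
        intro h
        have := h j
        rw [Function.update_self] at this
        exact (lt_of_lt_of_le ht this).false
      · refine Filter.Eventually.of_forall fun t => ?_
        rw [step_of_not_le hz, step_of_not_le]
        intro h
        have := h j
        rw [Function.update_of_ne hji] at this
        exact hj this

theorem RightContinuous.sub {f g : Cube (Fin d) → ℝ} (hf : RightContinuous f)
    (hg : RightContinuous g) : RightContinuous fun x => f x - g x :=
  fun x i => (hf x i).sub (hg x i)

/-! ### Uniqueness of the measure -/

/-- A finite measure is determined by its distribution function. -/
theorem measure_eq_of_distr_eq {μ ν : Measure (Cube (Fin d))} [IsFiniteMeasure μ]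
    [IsFiniteMeasure ν] (h : ∀ x, distr μ x = distr ν x) : μ = ν := by
  have hIic : ∀ x, μ (Set.Iic x) = ν (Set.Iic x) := by
    intro x
    have := h x
    rw [distr, distr, Icc_zero_eq_Iic] at this
    exact (measureReal_eq_measureReal_iff).1 this
  have huniv : (Set.univ : Set (Cube (Fin d))) = Set.Iic 1 :=
    (Set.eq_univ_of_forall fun z i => le_top).symm
  refine ext_of_generate_finite
    (Set.univ.pi '' Set.univ.pi fun _ : Fin d => Set.range (Set.Iic : unitInterval → _))
    (generateFrom_eq_pi (fun _ => ?_) fun _ => ?_).symm ?_ ?_ ?_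
  · rw [← borel_eq_generateFrom_Iic]
    exact (BorelSpace.measurable_eq).symm
  · refine ⟨fun _ => Set.Iic 1, fun _ => ⟨1, rfl⟩, ?_⟩
    rw [Set.iUnion_const]
    exact Set.eq_univ_of_forall fun z => Set.mem_Iic.2 le_top
  · exact IsPiSystem.pi fun _ => isPiSystem_Iic
  · rintro _ ⟨s, hs, rfl⟩
    choose x hx using fun i => hs i (Set.mem_univ i)
    obtain rfl : (fun i => Set.Iic (x i)) = s := funext hx
    rw [Set.pi_univ_Iic]
    exact hIic x
  · rw [huniv]
    exact hIic 1

theorem add_eq_add_of_distr_sub_eq {μ ν μ' ν' : Measure (Cube (Fin d))} [IsFiniteMeasure μ]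
    [IsFiniteMeasure ν] [IsFiniteMeasure μ'] [IsFiniteMeasure ν']
    (h : ∀ x, distr μ x - distr ν x = distr μ' x - distr ν' x) : μ + ν' = μ' + ν := by
  refine measure_eq_of_distr_eq fun x => ?_
  rw [distr_add, distr_add]
  linarith [h x]

/-- Mutually singular measures minimize the total mass among all pairs with a given difference. -/
theorem measure_univ_le_of_mutuallySingular {α : Type*} [MeasurableSpace α]
    {μ ν μ' ν' : Measure α} (hs : μ ⟂ₘ ν) (h : μ + ν' = μ' + ν) :
    (μ + ν) Set.univ ≤ (μ' + ν') Set.univ := by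
  obtain ⟨s, hs, h1, h2⟩ := hs
  have e1 := congrArg (fun m : Measure α => m sᶜ) h
  have e2 := congrArg (fun m : Measure α => m s) h
  simp only [Measure.add_apply, h1, h2, add_zero, zero_add] at e1 e2
  rw [← measure_add_measure_compl hs, Measure.add_apply, Measure.add_apply, h1, h2, zero_add,
    add_zero]
  calc ν s + μ sᶜ ≤ ν' Set.univ + μ' Set.univ := ?_
    _ = _ := by rw [Measure.add_apply, add_comm]
  have a1 : μ sᶜ ≤ μ' sᶜ := le_self_add.trans_eq e1
  have a2 : ν s ≤ ν' s := le_add_self.trans_eq e2.symm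
  exact add_le_add (a2.trans (measure_mono (Set.subset_univ _)))
    (a1.trans (measure_mono (Set.subset_univ _)))

end Distr

/-! ### Existence of the measure -/

section Existence

variable {d : ℕ}

/-- On a finite grid, `f` is the distribution function of a difference of discrete measures, whose
masses are controlled by the variation. -/
theorem exists_discrete (f : Cube (Fin d) → ℝ) (F : Finset unitInterval) :
    ∃ μ ν : Measure (Cube (Fin d)), IsFiniteMeasure μ ∧ IsFiniteMeasure ν ∧
      (∀ x : Cube (Fin d), (∀ i, x i ∈ F) → f x = distr μ x - distr ν x) ∧
      μ Set.univ + ν Set.univ ≤ varHK0 f + ENNReal.ofReal |f 0| := by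
  classical
  -- The positive and the negative grid weights give the two measures.
  set G := insert 0 F
  obtain ⟨w, hw⟩ := exists_grid_weight G f
  have hdirac : ∀ z x : Cube (Fin d), (Measure.dirac z (Set.Icc 0 x)).toReal = step z x := by
    intro z x
    rw [Measure.dirac_apply' _ measurableSet_Icc, Icc_zero_eq_Iic]
    by_cases h : z ≤ x
    · rw [step_of_le h, Set.indicator_of_mem (Set.mem_Iic.2 h)]
      simp
    · rw [step_of_not_le h, Set.indicator_of_notMem (mt Set.mem_Iic.1 h)]
      simp
  have hfin : ∀ v : Cube (Fin d) → ℝ, IsFiniteMeasure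
      (∑ z ∈ gridPts (Fin d) G, ENNReal.ofReal (v z) • Measure.dirac z) := by
    refine fun v => ⟨?_⟩
    rw [Measure.finsetSum_apply]
    refine ENNReal.sum_lt_top.2 fun z _ => ?_
    simp
  have hdistr : ∀ (v : Cube (Fin d) → ℝ) (x : Cube (Fin d)),
      distr (∑ z ∈ gridPts (Fin d) G, ENNReal.ofReal (v z) • Measure.dirac z) x =
        ∑ z ∈ gridPts (Fin d) G, max (v z) 0 * step z x := by
    intro v x
    rw [distr, measureReal_def, Measure.finsetSum_apply, ENNReal.toReal_sum]
    · refine Finset.sum_congr rfl fun z _ => ?_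
      rw [Measure.smul_apply, smul_eq_mul, ENNReal.toReal_mul, hdirac, ENNReal.toReal_ofReal']
    · intro z _
      rw [Measure.smul_apply, smul_eq_mul]
      exact ENNReal.mul_ne_top ENNReal.ofReal_ne_top (measure_ne_top _ _)
  refine ⟨_, _, hfin w, hfin fun z => -w z, fun x hx => ?_, ?_⟩
  · rw [hdistr, hdistr, ← Finset.sum_sub_distrib,
      hw x (mem_gridPts.2 fun i => Finset.mem_insert_of_mem (hx i))]
    refine Finset.sum_congr rfl fun z _ => ?_
    rw [← sub_mul]
    congr 1
    rcases le_total 0 (w z) with h | h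
    · rw [max_eq_left h, max_eq_right (by linarith), sub_zero]
    · rw [max_eq_right h, max_eq_left (by linarith)]
      ring
  · refine le_trans (le_of_eq ?_) (sum_weight_le (Finset.mem_insert_self 0 F) hw)
    rw [Measure.finsetSum_apply, Measure.finsetSum_apply, ← Finset.sum_add_distrib]
    refine Finset.sum_congr rfl fun z _ => ?_
    simp only [Measure.smul_apply, measure_univ, smul_eq_mul, mul_one]
    rcases le_total 0 (w z) with h | h
    · rw [ENNReal.ofReal_of_nonpos (p := -w z) (by linarith), add_zero, abs_of_nonneg h]
    · rw [ENNReal.ofReal_of_nonpos h, zero_add, abs_of_nonpos h]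

/-- Portmanteau theorem for finite measures and a closed set with null frontier. -/
theorem tendsto_real_of_null_frontier {Ω κ : Type*} [MeasurableSpace Ω] [TopologicalSpace Ω]
    [OpensMeasurableSpace Ω] [HasOuterApproxClosed Ω] {L : Filter κ} {μs : κ → FiniteMeasure Ω}
    {μ : FiniteMeasure Ω} (h : Filter.Tendsto μs L (nhds μ)) {A : Set Ω} (hA : IsClosed A)
    (hfr : (μ : Measure Ω) (frontier A) = 0) :
    Filter.Tendsto (fun k => (μs k : Measure Ω).real A) L (nhds ((μ : Measure Ω).real A)) := by
  have hcl : ∀ B : Set Ω, IsClosed B → ∀ ε : ℝ, 0 < ε →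
      ∀ᶠ k in L, (μs k : Measure Ω).real B < (μ : Measure Ω).real B + ε := by
    intro B hB ε hε
    have h1 := FiniteMeasure.limsup_measure_closed_le_of_tendsto h hB
    have h2 : (μ : Measure Ω) B < (μ : Measure Ω) B + ENNReal.ofReal ε :=
      ENNReal.lt_add_right (measure_ne_top _ _) (by simpa using hε)
    filter_upwards [Filter.eventually_lt_of_limsup_lt (h1.trans_lt h2)] with k hk
    have := (ENNReal.toReal_lt_toReal (measure_ne_top _ _) (by simp)).2 hk
    rwa [ENNReal.toReal_add (measure_ne_top _ _) ENNReal.ofReal_ne_top,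
      ENNReal.toReal_ofReal hε.le] at this
  have hmass : Filter.Tendsto (fun k => (μs k : Measure Ω).real Set.univ) L
      (nhds ((μ : Measure Ω).real Set.univ)) :=
    (NNReal.continuous_coe.tendsto _).comp h.mass
  have hint : (μ : Measure Ω).real (interior A)ᶜ =
      (μ : Measure Ω).real Set.univ - (μ : Measure Ω).real A := by
    rw [measureReal_compl isOpen_interior.measurableSet]
    congr 1
    rw [measureReal_def, measureReal_def]
    congr 1
    refine le_antisymm (measure_mono interior_subset) ?_
    calc (μ : Measure Ω) A ≤ (μ : Measure Ω) (interior A ∪ frontier A) := by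
          refine measure_mono ?_
          rw [← closure_eq_interior_union_frontier]
          exact subset_closure
      _ ≤ _ := (measure_union_le _ _).trans (by rw [hfr, add_zero])
  rw [Metric.tendsto_nhds]
  intro ε hε
  filter_upwards [hcl A hA ε hε, hcl _ isOpen_interior.isClosed_compl (ε / 2) (half_pos hε),
    Metric.tendsto_nhds.1 hmass (ε / 2) (half_pos hε)] with k h1 h2 h3
  rw [hint, measureReal_compl isOpen_interior.measurableSet] at h2
  have h4 : (μs k : Measure Ω).real (interior A) ≤ (μs k : Measure Ω).real A :=
    measureReal_mono interior_subset
  rw [Real.dist_eq, abs_lt] at h3 ⊢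
  constructor <;> linarith

/-- The coordinates of `x` equal to `1` do not contribute to the frontier, which is taken inside
the cube. -/
theorem frontier_Icc_zero_subset (x : Cube (Fin d)) :
    frontier (Set.Icc 0 x) ⊆ ⋃ i ∈ {i | x i ≠ 1}, {z : Cube (Fin d) | z i = x i} := by
  rw [Icc_zero_eq_Iic, isClosed_Iic.frontier_eq]
  rintro z ⟨hz, hz'⟩
  by_contra hcon
  simp only [Set.mem_iUnion, Set.mem_ofPred_eq, not_exists] at hcon
  refine hz' (mem_interior.2
    ⟨Set.univ.pi fun i => {t | x i ≠ 1 → t < x i}, fun y hy i => ?_, ?_, fun i _ hi => ?_⟩)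
  · by_cases hi : x i = 1
    · rw [hi]
      exact le_top
    · exact (hy i (Set.mem_univ i) hi).le
  · refine isOpen_set_pi Set.finite_univ fun i _ => ?_
    by_cases hi : x i = 1
    · simp [hi]
    · have : {t | x i ≠ 1 → t < x i} = Set.Iio (x i) := by
        ext t
        simp [hi]
      rw [this]
      exact isOpen_Iio
  · exact lt_of_le_of_ne (hz i) (hcon i hi)

theorem exists_mem_Ioo_notMem_of_countable {B : Set unitInterval} (hB : B.Countable)
    {t u : unitInterval} (htu : t < u) : ∃ s, t < s ∧ s < u ∧ s ∉ B := by
  by_contra hcon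
  push Not at hcon
  have h : Set.Ioo (t : ℝ) u ⊆ Subtype.val '' B := by
    intro r hr
    have hr' : r ∈ unitInterval := ⟨t.2.1.trans hr.1.le, hr.2.le.trans u.2.2⟩
    exact ⟨⟨r, hr'⟩, hcon ⟨r, hr'⟩ hr.1 hr.2, rfl⟩
  have := Cardinal.Real.Ioo_countable_iff.1 ((hB.image _).mono h)
  exact (lt_of_lt_of_le htu this).false

/-- Two right-continuous functions agree if they agree at all points whose coordinates are either
`1` or avoid a countable set. -/
theorem RightContinuous.eq_of_countable {f g : Cube (Fin d) → ℝ} (hf : RightContinuous f)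
    (hg : RightContinuous g) {B : Set unitInterval} (hB : B.Countable)
    (h : ∀ x : Cube (Fin d), (∀ i, x i = 1 ∨ x i ∉ B) → f x = g x) : f = g := by
  classical
  suffices H : ∀ (s : Finset (Fin d)) (x : Cube (Fin d)), (∀ i ∉ s, x i = 1 ∨ x i ∉ B) →
      f x = g x from funext fun x => H Finset.univ x (by simp)
  intro s
  induction s using Finset.induction_on with
  | empty => exact fun x hx => h x fun i => hx i (Finset.notMem_empty i)
  | insert i s his ih =>
    intro x hx
    by_cases hi1 : x i = 1
    · refine ih x fun j hj => ?_
      by_cases hji : j = i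
      · exact Or.inl (hji ▸ hi1)
      · exact hx j (by simp [hji, hj])
    by_contra hne
    have hx' : Function.update x i (x i) = x := Function.update_eq_self i x
    -- Move the `i`-th coordinate to the right, off `B`, where `f` and `g` agree by induction.
    have hlim := ((hf x i).sub (hg x i)).mono (Set.Ioi_subset_Ici_self)
    have hne' : f (Function.update x i (x i)) - g (Function.update x i (x i)) ≠ 0 := by
      rw [hx']
      exact sub_ne_zero.2 hne
    have hev := hlim.eventually_ne hne'
    have hlt : x i < 1 := lt_of_le_of_ne le_top hi1
    obtain ⟨u, hu, hu'⟩ := (mem_nhdsGT_iff_exists_Ioo_subset' hlt).1 hev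
    obtain ⟨t, ht1, ht2, htB⟩ := exists_mem_Ioo_notMem_of_countable hB hu
    refine hu' ⟨ht1, ht2⟩ (sub_eq_zero.2 (ih _ fun j hj => ?_))
    by_cases hji : j = i
    · subst hji
      rw [Function.update_self]
      exact Or.inr htB
    · rw [Function.update_of_ne hji]
      exact hx j (by simp [hji, hj])

/-- A right-continuous function of bounded HK0-variation is the distribution function of a
difference of two finite measures whose total mass is controlled by the variation. The measures are
limits of the discrete measures representing `f` on finite grids, along an ultrafilter containing
all the sets of grids finer than a given one. -/
theorem exists_measure_of_rightContinuous {f : Cube (Fin d) → ℝ} (hf : RightContinuous f)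
    (hvar : varHK0 f < ∞) :
    ∃ μ ν : Measure (Cube (Fin d)), IsFiniteMeasure μ ∧ IsFiniteMeasure ν ∧
      (∀ x, f x = distr μ x - distr ν x) ∧
      (μ + ν) Set.univ ≤ varHK0 f + ENNReal.ofReal |f 0| := by
  classical
  choose μ' ν' hμ' hν' hgrid hmass using exists_discrete f
  set C : NNReal := (varHK0 f + ENNReal.ofReal |f 0|).toNNReal
  have hC : (C : ℝ≥0∞) = varHK0 f + ENNReal.ofReal |f 0| :=
    ENNReal.coe_toNNReal (ENNReal.add_ne_top.2 ⟨hvar.ne, ENNReal.ofReal_ne_top⟩)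
  let μs : Finset unitInterval → FiniteMeasure (Cube (Fin d)) := fun F => ⟨μ' F, hμ' F⟩
  let νs : Finset unitInterval → FiniteMeasure (Cube (Fin d)) := fun F => ⟨ν' F, hν' F⟩
  have hsum : ∀ F, (μs F).mass + (νs F).mass ≤ C := by
    intro F
    rw [← ENNReal.coe_le_coe, ENNReal.coe_add, hC, FiniteMeasure.ennreal_mass,
      FiniteMeasure.ennreal_mass]
    exact hmass F
  let U : Ultrafilter (Finset unitInterval) := Ultrafilter.of Filter.atTop
  have hU : (U : Filter (Finset unitInterval)) ≤ Filter.atTop := Ultrafilter.of_le _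
  have hK := isCompact_setOfPred_finiteMeasure_le_of_compactSpace (Cube (Fin d)) C
  obtain ⟨μ, -, hμ⟩ := hK.ultrafilter_le_nhds' (U.map μs)
    (Ultrafilter.mem_map.2 (Filter.univ_mem' fun F => le_self_add.trans (hsum F)))
  obtain ⟨ν, -, hν⟩ := hK.ultrafilter_le_nhds' (U.map νs)
    (Ultrafilter.mem_map.2 (Filter.univ_mem' fun F => le_add_self.trans (hsum F)))
  have hμt : Filter.Tendsto μs U (nhds μ) := hμ
  have hνt : Filter.Tendsto νs U (nhds ν) := hν
  refine ⟨μ, ν, inferInstance, inferInstance, fun x => ?_, ?_⟩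
  -- Away from countably many values of each coordinate, `[0, x]` has a null frontier.
  · set B : Set unitInterval := ⋃ i : Fin d,
      {t | 0 < ((μ : Measure (Cube (Fin d))) + ν) {z | z i = t}}
    have hB : B.Countable := Set.countable_iUnion fun i =>
      Measure.countable_meas_level_set_pos (measurable_pi_apply i)
    have hgood : ∀ x : Cube (Fin d), (∀ i, x i = 1 ∨ x i ∉ B) →
        ((μ : Measure (Cube (Fin d))) + ν) (frontier (Set.Icc 0 x)) = 0 := by
      intro x hx
      refine measure_mono_null (frontier_Icc_zero_subset x)
        ((measure_biUnion_null_iff (Set.to_countable _)).2 fun i hi => ?_)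
      have := (hx i).resolve_left hi
      simp only [B, Set.mem_iUnion, not_exists] at this
      exact le_bot_iff.1 (not_lt.1 (this i))
    refine congrFun (hf.eq_of_countable
      ((rightContinuous_distr μ).sub (rightContinuous_distr ν)) hB fun x hx => ?_) x
    have h0 := hgood x hx
    rw [Measure.add_apply, add_eq_zero] at h0
    have ht := (tendsto_real_of_null_frontier hμt isClosed_Icc h0.1).sub
      (tendsto_real_of_null_frontier hνt isClosed_Icc h0.2)
    refine tendsto_nhds_unique (Filter.Tendsto.congr' ?_ tendsto_const_nhds) ht
    -- The discrete measures reproduce `f x` exactly as soon as the grid contains `x`.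
    filter_upwards [hU (Filter.eventually_ge_atTop (Finset.univ.image x))] with F hF
    exact hgrid F x fun i => hF (Finset.mem_image_of_mem x (Finset.mem_univ i))
  · have h : μ.mass + ν.mass ≤ C :=
      le_of_tendsto (hμt.mass.add hνt.mass) (Filter.Eventually.of_forall hsum)
    rw [← ENNReal.coe_le_coe, ENNReal.coe_add, hC, FiniteMeasure.ennreal_mass,
      FiniteMeasure.ennreal_mass] at h
    exact h

end Existence

/-! ### Total variation and Jordan decompositions -/

section Jordan

variable {d : ℕ}

/-- For mutually singular measures, the HK0-variation of the difference of the distribution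
functions is the mass outside the origin, and adding `|f 0|` gives the total mass. -/
theorem varHK0_eq_of_mutuallySingular {μ ν : Measure (Cube (Fin d))} [IsFiniteMeasure μ]
    [IsFiniteMeasure ν] (hs : μ ⟂ₘ ν) {f : Cube (Fin d) → ℝ}
    (hf : ∀ x, f x = distr μ x - distr ν x) :
    (μ + ν) Set.univ = varHK0 f + ENNReal.ofReal |f 0| ∧ varHK0 f = (μ + ν) {0}ᶜ := by
  obtain rfl : f = fun x => distr μ x - distr ν x := funext hf
  set f : Cube (Fin d) → ℝ := fun x => distr μ x - distr ν x
  have h1 : varHK0 f ≤ (μ + ν) {0}ᶜ := varHK0_distr_le μ ν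
  have h2 : ENNReal.ofReal |f 0| ≤ (μ + ν) {0} := by
    rw [← ofReal_measureReal (μ := μ + ν), measureReal_add_apply, ← distr_zero, ← distr_zero]
    refine ENNReal.ofReal_le_ofReal (abs_le.2 ⟨?_, ?_⟩) <;>
      linarith [distr_nonneg μ 0, distr_nonneg ν 0]
  have h3 : (μ + ν) Set.univ = (μ + ν) {0}ᶜ + (μ + ν) {0} := by
    rw [add_comm ((μ + ν) {0}ᶜ), measure_add_measure_compl (measurableSet_singleton 0)]
  -- The existence theorem gives a second pair with the same difference and total mass at most the
  -- variation; a mutually singular pair has the least mass.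
  obtain ⟨μ', ν', _, _, hd, hle⟩ := exists_measure_of_rightContinuous
    ((rightContinuous_distr μ).sub (rightContinuous_distr ν))
    (h1.trans_lt (measure_lt_top _ _))
  have h4 : (μ + ν) Set.univ ≤ varHK0 f + ENNReal.ofReal |f 0| :=
    (measure_univ_le_of_mutuallySingular hs (add_eq_add_of_distr_sub_eq hd)).trans hle
  refine ⟨le_antisymm h4 (h3 ▸ add_le_add h1 h2), le_antisymm h1 ?_⟩
  refine (ENNReal.add_le_add_iff_right (ENNReal.ofReal_ne_top (r := |f 0|))).1 ?_
  calc (μ + ν) {0}ᶜ + ENNReal.ofReal |f 0| ≤ (μ + ν) {0}ᶜ + (μ + ν) {0} := by gcongr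
    _ ≤ _ := h3 ▸ h4

theorem distr_restrict_compl_zero (μ : Measure (Cube (Fin d))) (x : Cube (Fin d)) :
    distr (μ.restrict {0}ᶜ) x = μ.real (Set.Icc 0 x \ {0}) := by
  rw [distr, measureReal_restrict_apply measurableSet_Icc, Set.sdiff_eq]

theorem distr_eq_zero_add (μ : Measure (Cube (Fin d))) [IsFiniteMeasure μ] (x : Cube (Fin d)) :
    distr μ x = distr μ 0 + distr (μ.restrict {0}ᶜ) x := by
  have h : ({0} : Set (Cube (Fin d))) ⊆ Set.Icc 0 x :=
    Set.singleton_subset_iff.2 ⟨le_rfl, fun _ => bot_le⟩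
  rw [distr_restrict_compl_zero, measureReal_sdiff h (measurableSet_singleton 0), distr_zero,
    distr]
  ring

theorem distr_restrict_compl_zero_zero (μ : Measure (Cube (Fin d))) :
    distr (μ.restrict {0}ᶜ) 0 = 0 := by
  rw [distr_restrict_compl_zero, Set.Icc_self, Set.sdiff_self, measureReal_empty]

theorem Icc_inter_Icc_eq_inf (x y : Cube (Fin d)) :
    Set.Icc 0 y ∩ Set.Icc 0 x = Set.Icc 0 (y ⊓ x) := by
  simp only [Icc_zero_eq_Iic]
  exact Set.Iic_inter_Iic

theorem distr_restrict_Icc (μ : Measure (Cube (Fin d))) (x y : Cube (Fin d)) :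
    distr (μ.restrict (Set.Icc 0 x)) y = distr μ (y ⊓ x) := by
  rw [distr, measureReal_restrict_apply measurableSet_Icc, Icc_inter_Icc_eq_inf, distr]

theorem distr_restrict_Icc_compl (μ : Measure (Cube (Fin d))) [IsFiniteMeasure μ]
    (x y : Cube (Fin d)) :
    distr (μ.restrict (Set.Icc 0 x)ᶜ) y = distr μ y - distr μ (y ⊓ x) := by
  rw [distr, measureReal_restrict_apply measurableSet_Icc, ← Set.sdiff_eq,
    distr, distr, ← Icc_inter_Icc_eq_inf]
  have := measureReal_inter_add_sdiff (μ := μ) (s := Set.Icc 0 y)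
    (measurableSet_Icc (a := 0) (b := x))
  linarith

theorem AnchoredMonotone.zero_le_one {h : Cube (Fin d) → ℝ} (hh : AnchoredMonotone h) :
    h 0 ≤ h 1 := by
  rw [← sub_nonneg, ← sum_quasiVolume_face]
  exact Finset.sum_nonneg fun S hS =>
    hh S (Finset.mem_filter.1 hS).2 0 1 fun _ => bot_le

theorem Icc_zero_one : Set.Icc (0 : Cube (Fin d)) 1 = Set.univ :=
  Set.eq_univ_of_forall fun _ => ⟨fun _ => bot_le, fun _ => le_top⟩

theorem inf_one_eq (x : Cube (Fin d)) : 1 ⊓ x = x := inf_eq_right.2 fun _ => le_top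

theorem inf_zero_eq (x : Cube (Fin d)) : 0 ⊓ x = 0 := inf_eq_left.2 fun _ => bot_le

/-- If the difference of two anchored monotone functions is that of the distribution functions of
mutually singular measures without mass at `0`, the masses are bounded by the increments. -/
theorem distr_one_le_of_mutuallySingular {μ ν : Measure (Cube (Fin d))} [IsFiniteMeasure μ]
    [IsFiniteMeasure ν] (hs : μ ⟂ₘ ν) (h0 : (μ + ν) {0} = 0) {p n : Cube (Fin d) → ℝ}
    (hp : AnchoredMonotone p) (hn : AnchoredMonotone n)
    (hpn : ∀ x, p x - n x = distr μ x - distr ν x) :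
    distr μ 1 + distr ν 1 ≤ (p 1 + n 1) - (p 0 + n 0) := by
  have h1 := (varHK0_eq_of_mutuallySingular hs hpn).2 ▸ varHK0_sub_le hp hn
  have h2 : (μ + ν) {0}ᶜ = ENNReal.ofReal (distr μ 1 + distr ν 1) := by
    rw [← distr_add, distr, Icc_zero_one, ofReal_measureReal,
      ← measure_add_measure_compl (measurableSet_singleton 0), h0, zero_add]
  rw [h2] at h1
  exact (ENNReal.ofReal_le_ofReal_iff
    (by linarith [hp.zero_le_one, hn.zero_le_one])).1 h1

/-- The sum of the two parts of a Jordan decomposition is the distribution function of the total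
variation measure away from the origin: the total variations over `[0, x]` and over its complement
are bounded by the increments of this sum, and over the whole cube equality holds. -/
theorem IsJordanDecomposition.add_eq {μ ν : Measure (Cube (Fin d))} [IsFiniteMeasure μ]
    [IsFiniteMeasure ν] (hs : μ ⟂ₘ ν) {f fp fm : Cube (Fin d) → ℝ}
    (hf : ∀ x, f x = distr μ x - distr ν x) (h : IsJordanDecomposition f fp fm)
    (x : Cube (Fin d)) :
    fp x + fm x = distr (μ.restrict {0}ᶜ) x + distr (ν.restrict {0}ᶜ) x := by
  have hvar := (varHK0_eq_of_mutuallySingular hs hf).2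
  set μ₀ := μ.restrict {0}ᶜ with hμ₀
  set ν₀ := ν.restrict {0}ᶜ with hν₀
  have hs₀ : μ₀ ⟂ₘ ν₀ := (hs.restrict _).symm.restrict _ |>.symm
  have hdiff : ∀ y, fp y - fm y = distr μ₀ y - distr ν₀ y := by
    intro y
    have e1 := h.eq_add_sub y
    rw [hf y, hf 0, distr_eq_zero_add μ y, distr_eq_zero_add ν y] at e1
    linarith
  have hz : ∀ s : Set (Cube (Fin d)), (μ₀.restrict s + ν₀.restrict s) {0} = 0 := by
    intro s
    have h1 : μ₀ {0} = 0 := by simp [hμ₀]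
    have h2 : ν₀ {0} = 0 := by simp [hν₀]
    rw [Measure.add_apply, Measure.absolutelyContinuous_of_le Measure.restrict_le_self h1,
      Measure.absolutelyContinuous_of_le Measure.restrict_le_self h2, add_zero]
  have hsing : ∀ s : Set (Cube (Fin d)), μ₀.restrict s ⟂ₘ ν₀.restrict s := fun s =>
    (hs₀.restrict s).symm.restrict s |>.symm
  have hp0 : 0 ≤ fp 0 := h.pos_zero.ge
  have hn0 : 0 ≤ fm 0 := h.neg_zero.ge
  have hin := distr_one_le_of_mutuallySingular (hsing (Set.Icc 0 x)) (hz _)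
    (h.pos_completelyMonotone.anchoredMonotone_inf hp0 x)
    (h.neg_completelyMonotone.anchoredMonotone_inf hn0 x) fun y => by
      rw [distr_restrict_Icc, distr_restrict_Icc, hdiff]
  have hout := distr_one_le_of_mutuallySingular (hsing (Set.Icc 0 x)ᶜ) (hz _)
    (h.pos_completelyMonotone.anchoredMonotone_sub_inf hp0 x)
    (h.neg_completelyMonotone.anchoredMonotone_sub_inf hn0 x) fun y => by
      rw [distr_restrict_Icc_compl, distr_restrict_Icc_compl]
      linarith [hdiff y, hdiff (y ⊓ x)]
  simp only [distr_restrict_Icc, distr_restrict_Icc_compl, inf_one_eq, inf_zero_eq, h.pos_zero,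
    h.neg_zero] at hin hout
  have htot : fp 1 + fm 1 ≤ distr μ₀ 1 + distr ν₀ 1 := by
    have e : (μ + ν) {0}ᶜ = ENNReal.ofReal (distr μ₀ 1 + distr ν₀ 1) := by
      rw [← distr_add, distr, Icc_zero_one, ofReal_measureReal, Measure.add_apply, Measure.add_apply, hμ₀, hν₀,
        Measure.restrict_apply_univ, Measure.restrict_apply_univ]
    have h1 := sub_le_varHK0 fp
    have h2 := sub_le_varHK0 fm
    rw [h.pos_zero, sub_zero] at h1
    rw [h.neg_zero, sub_zero] at h2
    have h3 : ENNReal.ofReal (fp 1 + fm 1) ≤ ENNReal.ofReal (distr μ₀ 1 + distr ν₀ 1) := by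
      rw [← e, ← hvar, h.varHK0_eq]
      exact ENNReal.ofReal_add_le.trans (add_le_add h1 h2)
    exact (ENNReal.ofReal_le_ofReal_iff
      (add_nonneg (distr_nonneg _ _) (distr_nonneg _ _))).1 h3
  linarith

/-- The Jordan decomposition of `f` is given by the Jordan decomposition of its measure. -/
theorem isJordanDecomposition_iff {μ ν : Measure (Cube (Fin d))} [IsFiniteMeasure μ]
    [IsFiniteMeasure ν] (hs : μ ⟂ₘ ν) {f : Cube (Fin d) → ℝ}
    (hf : ∀ x, f x = distr μ x - distr ν x) (fp fm : Cube (Fin d) → ℝ) :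
    IsJordanDecomposition f fp fm ↔
      ∀ x, fp x = μ.real (Set.Icc 0 x \ {0}) ∧ fm x = ν.real (Set.Icc 0 x \ {0}) := by
  simp only [← distr_restrict_compl_zero]
  constructor
  · intro h x
    have h1 := h.add_eq hs hf x
    have h2 := h.eq_add_sub x
    rw [hf x, hf 0, distr_eq_zero_add μ x, distr_eq_zero_add ν x] at h2
    constructor <;> linarith
  · intro h
    obtain rfl : fp = distr (μ.restrict {0}ᶜ) := funext fun x => (h x).1
    obtain rfl : fm = distr (ν.restrict {0}ᶜ) := funext fun x => (h x).2
    have hvar : ∀ (ρ : Measure (Cube (Fin d))) [IsFiniteMeasure ρ],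
        varHK0 (distr (ρ.restrict {0}ᶜ)) = ρ {0}ᶜ := by
      intro ρ _
      have := (varHK0_eq_of_mutuallySingular (μ := ρ.restrict {0}ᶜ) (ν := 0)
        Measure.MutuallySingular.zero_right (f := distr (ρ.restrict {0}ᶜ))
        fun x => by simp [distr]).2
      rw [this, add_zero, Measure.restrict_apply_self]
    refine ⟨distr_completelyMonotone _, distr_completelyMonotone _,
      distr_restrict_compl_zero_zero μ, distr_restrict_compl_zero_zero ν, fun x => ?_, ?_⟩
    · rw [hf x, hf 0, distr_eq_zero_add μ x, distr_eq_zero_add ν x]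
      ring
    · rw [(varHK0_eq_of_mutuallySingular hs hf).2, hvar, hvar, Measure.add_apply]

/-! ### Signed measures -/

theorem isDistributionFunction_iff {f : Cube (Fin d) → ℝ} {ν : SignedMeasure (Cube (Fin d))} :
    IsDistributionFunction f ν ↔ ∀ x, f x =
      distr ν.toJordanDecomposition.posPart x - distr ν.toJordanDecomposition.negPart x := by
  refine forall_congr' fun x => ?_
  rw [ν.apply_eq_posPart_real_sub_negPart_real measurableSet_Icc, distr, distr]

theorem IsDistributionFunction.unique {f : Cube (Fin d) → ℝ}
    {ν ν' : SignedMeasure (Cube (Fin d))} (h : IsDistributionFunction f ν)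
    (h' : IsDistributionFunction f ν') : ν = ν' := by
  rw [isDistributionFunction_iff] at h h'
  have e := add_eq_add_of_distr_sub_eq fun x => (h x).symm.trans (h' x)
  refine VectorMeasure.ext fun s hs => ?_
  rw [ν.apply_eq_posPart_real_sub_negPart_real hs, ν'.apply_eq_posPart_real_sub_negPart_real hs]
  have : (ν.toJordanDecomposition.posPart + ν'.toJordanDecomposition.negPart).real s =
      (ν'.toJordanDecomposition.posPart + ν.toJordanDecomposition.negPart).real s := by rw [e]
  rw [measureReal_add_apply, measureReal_add_apply] at this
  linarith

theorem RightContinuous.exists_isDistributionFunction {f : Cube (Fin d) → ℝ}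
    (hf : RightContinuous f) (hb : BoundedHK f) :
    ∃ ν : SignedMeasure (Cube (Fin d)), IsDistributionFunction f ν := by
  obtain ⟨μ, ν, _, _, h, -⟩ := exists_measure_of_rightContinuous hf hb.varHK0_lt_top
  refine ⟨μ.toSignedMeasure - ν.toSignedMeasure, fun x => ?_⟩
  rw [Measure.toSignedMeasure_sub_apply measurableSet_Icc, h]
  rfl

/-- The total variation of a signed measure and the Jordan decomposition of its distribution
function. -/
theorem IsDistributionFunction.totalVariation_and_jordan {f : Cube (Fin d) → ℝ}
    {ν : SignedMeasure (Cube (Fin d))} (h : IsDistributionFunction f ν) :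
    ν.totalVariation Set.univ = varHK0 f + ENNReal.ofReal |f 0| ∧
      ∀ fp fm : Cube (Fin d) → ℝ, IsJordanDecomposition f fp fm ↔
        ∀ x, fp x = ν.toJordanDecomposition.posPart.real (Set.Icc 0 x \ {0}) ∧
          fm x = ν.toJordanDecomposition.negPart.real (Set.Icc 0 x \ {0}) := by
  rw [isDistributionFunction_iff] at h
  have hs := ν.toJordanDecomposition.mutuallySingular
  exact ⟨(varHK0_eq_of_mutuallySingular hs h).1, isJordanDecomposition_iff hs h⟩

end Jordan

end HardyKrause

theorem theorem3 (d : ℕ) :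
    (∀ f : HardyKrause.Cube (Fin d) → ℝ,
      HardyKrause.RightContinuous f → HardyKrause.BoundedHK f →
        (∃! ν : SignedMeasure (HardyKrause.Cube (Fin d)),
          HardyKrause.IsDistributionFunction f ν) ∧
        ∀ ν : SignedMeasure (HardyKrause.Cube (Fin d)),
          HardyKrause.IsDistributionFunction f ν →
            ν.totalVariation Set.univ = HardyKrause.varHK0 f + ENNReal.ofReal |f 0| ∧
            ∀ fp fm : HardyKrause.Cube (Fin d) → ℝ,
              HardyKrause.IsJordanDecomposition f fp fm ↔
                ∀ x, fp x = ν.toJordanDecomposition.posPart.real (Set.Icc 0 x \ {0}) ∧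
                  fm x = ν.toJordanDecomposition.negPart.real (Set.Icc 0 x \ {0})) ∧
    (∀ ν : SignedMeasure (HardyKrause.Cube (Fin d)),
      ∃ f : HardyKrause.Cube (Fin d) → ℝ,
        (HardyKrause.RightContinuous f ∧ HardyKrause.BoundedHK f ∧
          HardyKrause.IsDistributionFunction f ν ∧
          ν.totalVariation Set.univ = HardyKrause.varHK0 f + ENNReal.ofReal |f 0|) ∧
        (∀ g : HardyKrause.Cube (Fin d) → ℝ,
          HardyKrause.RightContinuous g → HardyKrause.BoundedHK g →
            HardyKrause.IsDistributionFunction g ν → g = f) ∧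
        ∀ fp fm : HardyKrause.Cube (Fin d) → ℝ,
          HardyKrause.IsJordanDecomposition f fp fm ↔
            ∀ x, fp x = ν.toJordanDecomposition.posPart.real (Set.Icc 0 x \ {0}) ∧
              fm x = ν.toJordanDecomposition.negPart.real (Set.Icc 0 x \ {0})) := by
  refine ⟨fun f hf hb => ⟨?_, fun ν hν => hν.totalVariation_and_jordan⟩, fun ν => ?_⟩
  · obtain ⟨ν, hν⟩ := hf.exists_isDistributionFunction hb
    exact ⟨ν, hν, fun ν' hν' => hν'.unique hν⟩
  · have h : HardyKrause.IsDistributionFunction (fun x =>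
        HardyKrause.distr ν.toJordanDecomposition.posPart x -
          HardyKrause.distr ν.toJordanDecomposition.negPart x) ν :=
      HardyKrause.isDistributionFunction_iff.2 fun _ => rfl
    exact ⟨_, ⟨(HardyKrause.rightContinuous_distr _).sub (HardyKrause.rightContinuous_distr _),
      HardyKrause.boundedHK_distr _ _, h, h.totalVariation_and_jordan.1⟩,
      fun g _ _ hg => funext fun x => (hg x).trans (h x).symm, h.totalVariation_and_jordan.2⟩
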